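/- Let $\lambda>0$ and consider the linear D2Q13 lattice Boltzmann scheme at zero advection velocity. Its velocities are $v_j=\lambda\xi_j$ with $\xi_0,\dots,\xi_{12}=(0,0)$, $(1,0),(0,1),(-1,0),(0,-1)$, $(1,1),(-1,1),(-1,-1),(1,-1)$, $(2,0),(0,2),(-2,0),(0,-2)$. Its moments are $m_k=\sum_j p_k(v_j)f_j$, $0\le k\le 12$, named $\rho,j_x,j_y,E,XX,XY,q_x,q_y,r_x,r_y,E_2,E_3,XX_e$, where, with $r^2=X^2+Y^2$, the polynomials $p_k$ are in this order $1$, $X$, $Y$, $-28\lambda^2+13r^2$, $X^2-Y^2$, $XY$, $X(r^2-3\lambda^2)$, $Y(r^2-3\lambda^2)$, $X\,p$, $Y\,p$ with $p=\frac{101}{6}\lambda^4-\frac{63}{4}\lambda^2r^2+\frac{35}{12}r^4$, $140\lambda^4-\frac{361}{2}\lambda^2r^2+\frac{77}{2}r^4$, $-12\lambda^6+\frac{581}{12}\lambda^4r^2-\frac{273}{8}\lambda^2r^4+\frac{137}{24}r^6$, $(X^2-Y^2)\left(-\frac{65}{12}\lambda^2+\frac{17}{12}r^2\right)$. One time step is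 $f_j(x,t+\Delta t)=f_j^*(x-v_j\Delta t,t)$, where $f^*$ has the moments $m_k^*=m_k+s_k(m_k^{\rm eq}-m_k)$. The moments $W=(\rho,j_x,j_y,E)$ are conserved. The relaxation rates are $s_5$ for $XX,XY$; $s_7$ for $q$; $s_9$ for $r$; $s_{11}$ for $E_2$; $s_{12}$ for $E_3$; $s_{13}$ for $XX_e$; they are nonzero real numbers, and $\sigma_k=\frac1{s_k}-\frac12$. The equilibria are $$XX^{\rm eq}=XY^{\rm eq}=0,\quad q^{\rm eq}=(2c_0^2-3\lambda^2)\,j,\quad r^{\rm eq}=\tfrac{\lambda^2}{12}\,(62\lambda^2-63c_0^2)\,j,\quad E_2^{\rm eq}=\alpha_2\lambda^4\rho+\beta_2\lambda^2E,$$ $$E_3^{\rm eq}=\alpha_3\lambda^6\rho+\beta_3\lambda^4E,\qquad XX_e^{\rm eq}=\xi_x\left(\lambda^4\rho+\tfrac{\lambda^2}{28}E\right),$$ with real coefficients. Let $\partial_tW+L\,W={\rm O}(\Delta t^4)$, $L=A_0+\Delta t\,A_1+\Delta t^2A_2+\Delta t^3A_3$, be the fourth-order equivalent partial differential equation of the scheme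 (formal Taylor expansion in $\Delta t$ at fixed $\lambda$). In Fourier variables, $\nabla=-i\mathbf k$, $\Delta=-|\mathbf k|^2$, $\sqrt\Delta=i|\mathbf k|$, the $A_n$ are $4\times4$ matrices depending on $\mathbf k\in\mathbb R^2$. The eigenvalues of $\partial_t+L$ up to ${\rm O}(\Delta t^4)$ are the diagonal entries after a change of variables $R(\Delta t)$, invertible at $\Delta t=0$, which diagonalizes $L$ up to ${\rm O}(\Delta t^4)$. The scheme is isotropic at fourth order if these eigenvalues are functions of the Laplacian only, that is, if there are real constants $a_j,b_j,d_j$ ($j=1,2,3$), independent of $\mathbf k$, such that for every $\mathbf k\in\mathbb R^2$ the eigenvalues are, up to ${\rm O}(\Delta t^4)$, $$\partial_t+\Delta t\,a_j\Delta+\Delta t^2\,b_j\Delta\sqrt\Delta+\Delta t^3\,d_j\Delta^2\quad(j=1,2),$$ $$\partial_t\pm c_0\sqrt\Delta+\Delta t\,a_3\Delta\pm\Delta t^2\,b_3\Delta\sqrt\Delta+\Delta t^3\,d_3\Delta^2 .$$ **Theorem.** Let $\alpha_2,\beta_2\in\mathbb R$ and nonzero $s_{11},s_{12}$ be arbitrary,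 let $\sigma_5\neq0$, and suppose that $$\sigma_7=\frac1{12\,\sigma_5},\qquad c_0=\frac2{\sqrt5}\,\lambda,\qquad \xi_x=0,\qquad \sigma_9=\sigma_7,\qquad \sigma_{13}=\sigma_5,$$ $$\alpha_3=-\frac1{1716}\,\frac{N_\alpha}{384\sigma_5^2+7},\qquad \beta_3=\frac1{216216}\,\frac{N_\beta}{384\sigma_5^2+7},$$ $$N_\alpha=41922-2505\,\alpha_2+54800\,\beta_2+(14098944+97440\,\alpha_2+1315200\,\beta_2)\,\sigma_5^2,$$ $$N_\beta=-2756851+34250\,\alpha_2-889970\,\beta_2-(204329472-822000\,\alpha_2+41211840\,\beta_2)\,\sigma_5^2 .$$ Then the fourth-order equivalent equation exists and the scheme is isotropic at fourth order; that is, all the equations of fourth-order isotropy are satisfied. -/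

import Mathlib

open PowerSeries Matrix

noncomputable section

namespace D2Q13

/-- The parameters of the linear D2Q13 scheme around a state of zero velocity: the velocity scale
`lam`, the sound velocity `c0`, the coefficients of the equilibria of `E₂`, `E₃` and `XXₑ`, and the
relaxation rates. -/
structure Params where
  lam : ℝ
  c0 : ℝ
  alpha2 : ℝ
  beta2 : ℝ
  alpha3 : ℝ
  beta3 : ℝ
  xi : ℝ
  s5 : ℝ
  s7 : ℝ
  s9 : ℝ
  s11 : ℝ
  s12 : ℝ
  s13 : ℝ

/-- The dissipation coefficient `σ = 1 / s - 1 / 2` of a relaxation rate `s`. -/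
def sigma (s : ℝ) : ℝ := 1 / s - 1 / 2

/-- The 13 dimensionless velocities. -/
def dir : Fin 13 → ℤ × ℤ :=
  ![(0, 0), (1, 0), (0, 1), (-1, 0), (0, -1), (1, 1), (-1, 1), (-1, -1), (1, -1),
    (2, 0), (0, 2), (-2, 0), (0, -2)]

/-- The discrete velocities `v_j = lam ξ_j`. -/
def vel (lam : ℝ) (j : Fin 13) : ℝ × ℝ := (lam * (dir j).1, lam * (dir j).2)

/-- The 13 polynomials that define the moments
`ρ, j_x, j_y, E, XX, XY, q_x, q_y, r_x, r_y, E₂, E₃, XXₑ` (in this order). -/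
def momentPoly (lam X Y : ℝ) : Fin 13 → ℝ :=
  ![1,
    X,
    Y,
    -28 * lam ^ 2 + 13 * (X ^ 2 + Y ^ 2),
    X ^ 2 - Y ^ 2,
    X * Y,
    X * (-3 * lam ^ 2 + (X ^ 2 + Y ^ 2)),
    Y * (-3 * lam ^ 2 + (X ^ 2 + Y ^ 2)),
    X * (101 / 6 * lam ^ 4 - 63 / 4 * lam ^ 2 * (X ^ 2 + Y ^ 2)
      + 35 / 12 * (X ^ 2 + Y ^ 2) ^ 2),
    Y * (101 / 6 * lam ^ 4 - 63 / 4 * lam ^ 2 * (X ^ 2 + Y ^ 2)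
      + 35 / 12 * (X ^ 2 + Y ^ 2) ^ 2),
    140 * lam ^ 4 - 361 / 2 * lam ^ 2 * (X ^ 2 + Y ^ 2) + 77 / 2 * (X ^ 2 + Y ^ 2) ^ 2,
    -12 * lam ^ 6 + 581 / 12 * lam ^ 4 * (X ^ 2 + Y ^ 2)
      - 273 / 8 * lam ^ 2 * (X ^ 2 + Y ^ 2) ^ 2 + 137 / 24 * (X ^ 2 + Y ^ 2) ^ 3,
    (X ^ 2 - Y ^ 2) * (-65 / 12 * lam ^ 2 + 17 / 12 * (X ^ 2 + Y ^ 2))]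

/-- The moment matrix `M_{kj} = p_k(v_j)`; the moments of `f` are `m = M f`. -/
def momentMatrix (lam : ℝ) : Matrix (Fin 13) (Fin 13) ℝ :=
  Matrix.of fun k j => momentPoly lam (vel lam j).1 (vel lam j).2 k

/-- The equilibrium values of the 13 moments, as a linear function of the conserved moments
`(ρ, j_x, j_y, E)`:
`XX = XY = 0`, `q = (2 c0² - 3 lam²) j`, `r = lam² / 12 (62 lam² - 63 c0²) j`,
`E₂ = α₂ lam⁴ ρ + β₂ lam² E`, `E₃ = α₃ lam⁶ ρ + β₃ lam⁴ E`,
`XXₑ = ξ (lam⁴ ρ + lam² / 28 E)`. -/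
def equilibrium (P : Params) : Matrix (Fin 13) (Fin 4) ℝ :=
  !![1, 0, 0, 0;
     0, 1, 0, 0;
     0, 0, 1, 0;
     0, 0, 0, 1;
     0, 0, 0, 0;
     0, 0, 0, 0;
     0, 2 * P.c0 ^ 2 - 3 * P.lam ^ 2, 0, 0;
     0, 0, 2 * P.c0 ^ 2 - 3 * P.lam ^ 2, 0;
     0, P.lam ^ 2 / 12 * (62 * P.lam ^ 2 - 63 * P.c0 ^ 2), 0, 0;
     0, 0, P.lam ^ 2 / 12 * (62 * P.lam ^ 2 - 63 * P.c0 ^ 2), 0;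
     P.alpha2 * P.lam ^ 4, 0, 0, P.beta2 * P.lam ^ 2;
     P.alpha3 * P.lam ^ 6, 0, 0, P.beta3 * P.lam ^ 4;
     P.xi * P.lam ^ 4, 0, 0, P.xi * (P.lam ^ 2 / 28)]

/-- The relaxation rates of the 13 moments. The value for the four conserved moments is immaterial,
because these moments agree with their equilibrium values. -/
def rates (P : Params) : Fin 13 → ℝ :=
  ![0, 0, 0, 0, P.s5, P.s5, P.s7, P.s7, P.s9, P.s9, P.s11, P.s12, P.s13]

/-- The projection of the 13 moments to the four conserved ones. -/
def conserved : Matrix (Fin 4) (Fin 13) ℝ :=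
  Matrix.of fun a k => if (k : ℕ) = (a : ℕ) then 1 else 0

/-- The collision `m* = m + s (m_eq - m)`, with `m_eq = equilibrium (conserved m)`. -/
def collision (P : Params) : Matrix (Fin 13) (Fin 13) ℝ :=
  1 + Matrix.diagonal (rates P) * (equilibrium P * conserved - 1)

/-- A constant real matrix, seen as a matrix of formal power series. -/
def const {m n : Type*} (A : Matrix m n ℝ) : Matrix m n ℂ⟦X⟧ :=
  A.map fun x => PowerSeries.C (x : ℂ)

/-- One time step of the scheme, `f_j(x, t + Δt) = f_j*(x - v_j Δt, t)`, acting on the moments of a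
wave `exp (-i k·x)`, as a formal power series in the time step `Δt = X`. With `∇ = -i k` the shift
by `v_j Δt` is the multiplication by `exp (-Δt v_j·∇) = exp (i (k·v_j) Δt)`. -/
def timeStep (P : Params) (k : ℝ × ℝ) : Matrix (Fin 13) (Fin 13) ℂ⟦X⟧ :=
  const (momentMatrix P.lam) *
    Matrix.diagonal (fun j => PowerSeries.rescale
      (Complex.I * ((k.1 * (vel P.lam j).1 + k.2 * (vel P.lam j).2 : ℝ) : ℂ))
      (PowerSeries.exp ℂ)) *
    const (momentMatrix P.lam)⁻¹ * const (collision P)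

/-- `A = B + O(Δt ^ N)`, entry by entry. -/
def EqUpTo {m n : Type*} (N : ℕ) (A B : Matrix m n ℂ⟦X⟧) : Prop :=
  ∀ i j, (X : ℂ⟦X⟧) ^ N ∣ A i j - B i j

/-- `exp (-Δt L)` up to `O(Δt ^ 5)`: the evolution during one time step of the solutions of
`∂_t W + L W = 0`. -/
def evolution (L : Matrix (Fin 4) (Fin 4) ℂ⟦X⟧) : Matrix (Fin 4) (Fin 4) ℂ⟦X⟧ :=
  ∑ m ∈ Finset.range 5, PowerSeries.C ((m.factorial : ℂ)⁻¹) • ((-X : ℂ⟦X⟧) • L) ^ m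

/-- `∂_t W + L W = O(Δt ^ 4)` is the equivalent partial differential equation, at fourth order of
accuracy, of the scheme, where `L = A₀ + Δt A₁ + Δt² A₂ + Δt³ A₃ + ⋯` is given by its symbol at the
wave vector `k` (`∇ = -i k`): for suitable expansions `m = Ψ W` of all the moments in terms of the
conserved moments `W`, a solution `W` of this equation satisfies the scheme up to `O(Δt ^ 5)`
in each time step. -/
def IsEquivalentOperator (P : Params) (k : ℝ × ℝ) (L : Matrix (Fin 4) (Fin 4) ℂ⟦X⟧) : Prop :=
  ∃ Ψ : Matrix (Fin 13) (Fin 4) ℂ⟦X⟧,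
    const conserved * Ψ = 1 ∧ EqUpTo 5 (Ψ * evolution L) (timeStep P k * Ψ)

/-- The eigenvalues of `L` are `ev 0, …, ev 3` up to `O(Δt ^ 4)`: a change of variables `R`,
invertible at `Δt = 0`, diagonalizes `L` up to `O(Δt ^ 4)`. -/
def HasEigenvaluesUpTo4 (L : Matrix (Fin 4) (Fin 4) ℂ⟦X⟧) (ev : Fin 4 → ℂ⟦X⟧) : Prop :=
  ∃ R : Matrix (Fin 4) (Fin 4) ℂ⟦X⟧, IsUnit R.det ∧ EqUpTo 4 (L * R) (R * Matrix.diagonal ev)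

/-- The symbol `-|k|²` of the Laplacian. -/
def lap (k : ℝ × ℝ) : ℂ := -((k.1 ^ 2 + k.2 ^ 2 : ℝ) : ℂ)

/-- The symbol `i |k|` of the square root of the Laplacian. -/
def sqrtLap (k : ℝ × ℝ) : ℂ := Complex.I * (Real.sqrt (k.1 ^ 2 + k.2 ^ 2) : ℂ)

/-- `e₀ √Δ + Δt a Δ + Δt² b Δ √Δ + Δt³ d Δ²` -/
def isotropicSeries (k : ℝ × ℝ) (e0 a b d : ℝ) : ℂ⟦X⟧ :=
  PowerSeries.C ((e0 : ℂ) * sqrtLap k)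
    + PowerSeries.C ((a : ℂ) * lap k) * X
    + PowerSeries.C ((b : ℂ) * (lap k * sqrtLap k)) * X ^ 2
    + PowerSeries.C ((d : ℂ) * lap k ^ 2) * X ^ 3

/-- Isotropy at fourth order: the fourth order equivalent equation of the scheme exists, and its
shear, thermal and two acoustic eigenvalues `∂_t + ⋯` depend on the space derivatives only through
the Laplacian, up to `O(Δt ^ 4)`. The coefficients `a, b, d` do not depend on `k`. -/
def FourthOrderIsotropic (P : Params) : Prop :=
  ∃ a b d : Fin 3 → ℝ, ∀ k : ℝ × ℝ,
    (∃ L, IsEquivalentOperator P k L) ∧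
    ∀ L, IsEquivalentOperator P k L →
      HasEigenvaluesUpTo4 L
        ![isotropicSeries k 0 (a 0) (b 0) (d 0),
          isotropicSeries k 0 (a 1) (b 1) (d 1),
          isotropicSeries k P.c0 (a 2) (b 2) (d 2),
          isotropicSeries k (-P.c0) (a 2) (-b 2) (d 2)]

/-- The numerator of `α₃` (up to a sign), with `s` for `σ₅`. -/
def numAlpha (alpha2 beta2 s : ℝ) : ℝ :=
  41922 - 2505 * alpha2 + 54800 * beta2
    + (14098944 + 97440 * alpha2 + 1315200 * beta2) * s ^ 2

/-- The numerator of `β₃`, with `s` for `σ₅`. -/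
def numBeta (alpha2 beta2 s : ℝ) : ℝ :=
  -2756851 + 34250 * alpha2 - 889970 * beta2
    - (204329472 - 822000 * alpha2 + 41211840 * beta2) * s ^ 2

end D2Q13

end

/-! The eigenvalues are computed directly from eigenmodes of one time step. Let `f` and `f*` be the
populations of a mode before and after collision. Transport by `exp(i k·v_j Δt)` multiplies the mode
by `exp(-Δt ev)`, so `exp(ω) f* = f` with `ω = Δt (i k·v_j + ev)`. For the mean `g = (f + f*)/2` and
the jump `τ = f - f*` this says `τ = 2 tanh(ω/2) g`, which is `(ω - ω³/12) g` up to fourth order. In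
moments, with `h` the mean and `θ` the jump, the collision becomes `h = h_eq + σ θ`, and
conservation says that the first four entries of `θ` vanish. In the variable `Y = iλΔt` all
coefficients are real, and `IsMode` is this recursion.

Each longitudinal mode is sought as a polynomial in `k` with the symmetries of the square, which
turns the recursion into equations for finitely many coefficients. Isotropy asks only the eigenvalue
to be a function of `|k|`; the third-order moments of the mode may be anisotropic. At third order
`12 σ₅ σ₇ = 1` makes the two momentum equations coincide. At fourth order the unknown moments and
the eigenvalue coefficient absorb all equations but one linear condition for the thermal mode and
one for the acoustic modes (`residual_thermal`, `residual_acoustic`). The given `α₃` and `β₃` solve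
these two conditions. The shear mode is explicit and needs only `12 σ₅ σ₇ = 1`.

The four modes are independent at `Δt = 0` when `k ≠ 0`, so they produce an equivalent operator
together with its diagonalization. This operator is unique up to `O(Δt⁴)`
(`IsEquivalentOperator.unique`), so its eigenvalues are those of every equivalent operator. -/

noncomputable section

namespace D2Q13

/-! ### Dimensionless moments and advection -/

/-- The values of the moment polynomials at the 13 velocities, for `lam = 1`. -/
def momentTable : Matrix (Fin 13) (Fin 13) ℤ :=
  !![1, 1, 1, 1, 1, 1, 1, 1, 1, 1, 1, 1, 1;
     0, 1, 0, -1, 0, 1, -1, -1, 1, 2, 0, -2, 0;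
     0, 0, 1, 0, -1, 1, 1, -1, -1, 0, 2, 0, -2;
     -28, -15, -15, -15, -15, -2, -2, -2, -2, 24, 24, 24, 24;
     0, 1, -1, 1, -1, 0, 0, 0, 0, 4, -4, 4, -4;
     0, 0, 0, 0, 0, 1, -1, 1, -1, 0, 0, 0, 0;
     0, -2, 0, 2, 0, -1, 1, 1, -1, 2, 0, -2, 0;
     0, 0, -2, 0, 2, -1, -1, 1, 1, 0, 2, 0, -2;
     0, 4, 0, -4, 0, -3, 3, 3, -3, 1, 0, -1, 0;
     0, 0, 4, 0, -4, -3, -3, 3, 3, 0, 1, 0, -1;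
     140, -2, -2, -2, -2, -67, -67, -67, -67, 34, 34, 34, 34;
     -12, 8, 8, 8, 8, -6, -6, -6, -6, 1, 1, 1, 1;
     0, -4, 4, -4, 4, 0, 0, 0, 0, 1, -1, 1, -1]

/-- The squared norms of the rows of `momentTable`, which are orthogonal. -/
def momentNorm : Fin 13 → ℤ :=
  ![13, 14, 14, 4004, 68, 4, 20, 20, 70, 70, 42196, 548, 68]

/-- The degrees of the moment polynomials in the velocities. -/
def momentDegree : Fin 13 → ℕ := ![0, 1, 1, 2, 2, 2, 3, 3, 5, 5, 4, 6, 4]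

theorem momentTable_mul_transpose :
    momentTable * momentTableᵀ = Matrix.diagonal momentNorm := by
  decide +kernel

/-- The dimensionless moments `M g` of populations `g`. -/
def moments (g : Fin 13 → ℝ) : Fin 13 → ℝ := (momentTable.map fun x => (x : ℝ)) *ᵥ g

/-- The dimensionless wave numbers `k·ξ_j`. -/
def wave (kx ky : ℝ) (j : Fin 13) : ℝ := kx * (dir j).1 + ky * (dir j).2

/-- The multiplication of the populations by `k·ξ_j`, seen on the moments. -/
def advect (kx ky : ℝ) (h : Fin 13 → ℝ) : Fin 13 → ℝ :=
  ![kx * h 1 + ky * h 2,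
    kx * (14/13 * h 0 + 1/26 * h 3 + 1/2 * h 4) + ky * h 5,
    kx * h 5 + ky * (14/13 * h 0 + 1/26 * h 3 - 1/2 * h 4),
    kx * (11 * h 1 + 13 * h 6) + ky * (11 * h 2 + 13 * h 7),
    kx * (17/7 * h 1 + 7/5 * h 6 + 12/35 * h 8) + ky * (-17/7 * h 2 - 7/5 * h 7 - 12/35 * h 9),
    kx * (2/7 * h 2 - 1/5 * h 7 - 6/35 * h 9) + ky * (2/7 * h 1 - 1/5 * h 6 - 6/35 * h 8),
    kx * (5/77 * h 3 + 7/17 * h 4 + 1/77 * h 10 + 6/17 * h 12) + ky * (-h 5),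
    kx * (-h 5) + ky * (5/77 * h 3 - 7/17 * h 4 + 1/77 * h 10 - 6/17 * h 12),
    kx * (6/17 * h 4 + 3/137 * h 10 + 35/137 * h 11 - 7/17 * h 12) + ky * (-3 * h 5),
    kx * (-3 * h 5) + ky * (-6/17 * h 4 + 3/137 * h 10 + 35/137 * h 11 + 7/17 * h 12),
    kx * (137/5 * h 6 + 66/5 * h 8) + ky * (137/5 * h 7 + 66/5 * h 9),
    kx * 2 * h 8 + ky * 2 * h 9,
    kx * (6/5 * h 6 - 2/5 * h 8) + ky * (-6/5 * h 7 + 2/5 * h 9)]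

set_option maxHeartbeats 2000000 in
-- `advect` is the moment matrix conjugating the diagonal of `k·ξ_j`. Stated as an intertwining
-- relation, it is checked row by row without any inverse matrix.
theorem moments_wave (kx ky : ℝ) (g : Fin 13 → ℝ) :
    moments (fun j => wave kx ky j * g j) = advect kx ky (moments g) := by
  have key (f : Fin 13 → ℝ) (i : Fin 13) :
      moments f i = ∑ j, (momentTable i j : ℝ) * f j := rfl
  ext i
  fin_cases i <;>
    simp only [advect, key, wave, dir, momentTable, Fin.sum_univ_succ, Fin.sum_univ_zero] <;>
    simp <;> ring

/-- Orthogonality of the rows gives the right inverse: the transpose, with each moment divided by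
the squared norm of its row. -/
theorem exists_moments_eq (h : Fin 13 → ℝ) : ∃ g, moments g = h := by
  have key : (momentTable.map fun x => (x : ℝ)) * (momentTable.map fun x => (x : ℝ))ᵀ
      = Matrix.diagonal fun i => (momentNorm i : ℝ) := by
    have := congrArg (fun A : Matrix (Fin 13) (Fin 13) ℤ => A.map (Int.castRingHom ℝ))
      momentTable_mul_transpose
    simp only [Matrix.map_mul, Matrix.diagonal_map (map_zero _), Matrix.transpose_map] at this
    exact this
  refine ⟨(momentTable.map fun x => (x : ℝ))ᵀ *ᵥ fun i => h i / momentNorm i, ?_⟩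
  rw [moments, Matrix.mulVec_mulVec, key]
  ext i
  rw [Matrix.mulVec_diagonal]
  refine mul_div_cancel₀ _ ?_
  fin_cases i <;> simp [momentNorm]

/-- The moment polynomials for `lam = 1`, multiplied by 24. -/
def momentPolyInt (x y : ℤ) : Fin 13 → ℤ :=
  ![24, 24 * x, 24 * y, 24 * (-28 + 13 * (x ^ 2 + y ^ 2)), 24 * (x ^ 2 - y ^ 2), 24 * (x * y),
    24 * (x * (-3 + (x ^ 2 + y ^ 2))), 24 * (y * (-3 + (x ^ 2 + y ^ 2))),
    x * (404 - 378 * (x ^ 2 + y ^ 2) + 70 * (x ^ 2 + y ^ 2) ^ 2),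
    y * (404 - 378 * (x ^ 2 + y ^ 2) + 70 * (x ^ 2 + y ^ 2) ^ 2),
    3360 - 4332 * (x ^ 2 + y ^ 2) + 924 * (x ^ 2 + y ^ 2) ^ 2,
    -288 + 1162 * (x ^ 2 + y ^ 2) - 819 * (x ^ 2 + y ^ 2) ^ 2 + 137 * (x ^ 2 + y ^ 2) ^ 3,
    (x ^ 2 - y ^ 2) * (-130 + 34 * (x ^ 2 + y ^ 2))]

/-- The factor 24 clears the denominators, so a decision over the integers suffices. -/
theorem momentPolyInt_dir :
    ∀ i j, momentPolyInt (dir j).1 (dir j).2 i = 24 * momentTable i j := by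
  decide +kernel

theorem momentPoly_eq (lam : ℝ) (x y : ℤ) (i : Fin 13) :
    momentPoly lam (lam * x) (lam * y) i
      = lam ^ momentDegree i * ((momentPolyInt x y i : ℤ) : ℝ) / 24 := by
  fin_cases i <;> simp [momentPoly, momentPolyInt, momentDegree] <;> ring

/-- Each moment polynomial is homogeneous in `(λ, X, Y)`, so `λ` enters only through a power per
moment. -/
theorem momentMatrix_mulVec (lam : ℝ) (g : Fin 13 → ℝ) (i : Fin 13) :
    (momentMatrix lam *ᵥ g) i = lam ^ momentDegree i * moments g i := by
  simp only [moments, Matrix.mulVec, dotProduct, Finset.mul_sum]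
  refine Finset.sum_congr rfl fun j _ => ?_
  simp only [momentMatrix, vel, Matrix.of_apply, Matrix.map_apply, momentPoly_eq,
    momentPolyInt_dir]
  push_cast
  ring

theorem isUnit_momentMatrix {lam : ℝ} (hlam : lam ≠ 0) : IsUnit (momentMatrix lam) := by
  rw [← Matrix.mulVec_surjective_iff_isUnit]
  intro h
  obtain ⟨g, hg⟩ := exists_moments_eq fun i => h i / lam ^ momentDegree i
  refine ⟨g, funext fun i => ?_⟩
  rw [momentMatrix_mulVec, hg]
  field_simp

/-! ### The recursion for an eigenmode -/

/-- The coefficients `σ` of the 13 moments when `σ₉ = σ₇ = t` and `σ₁₃ = σ₅ = s`. -/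
def dissipation (s t s11 s12 : ℝ) : Fin 13 → ℝ :=
  ![0, 0, 0, 0, s, s, t, t, t, t, s11, s12, s]

/-- The dimensionless equilibrium when `c₀² = 4/5 lam²` and `ξ = 0`. -/
def equil (al2 be2 al3 be3 : ℝ) (h : Fin 13 → ℝ) : Fin 13 → ℝ :=
  ![h 0, h 1, h 2, h 3, 0, 0, -7/5 * h 1, -7/5 * h 2, 29/30 * h 1, 29/30 * h 2,
    al2 * h 0 + be2 * h 3, al3 * h 0 + be3 * h 3, 0]

/-- Multiplication by `k·ξ_j + e`, seen on the moments. -/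
def shift (kx ky e : ℝ) (h : Fin 13 → ℝ) : Fin 13 → ℝ := advect kx ky h + e • h

/-- The coefficients of order `1, …, 4` of `τ(ω) h`, where `τ(ω) = ω - ω³/12` and `ω` is the
multiplication by `(k·ξ_j + e₁) Y + e₂ Y² + e₃ Y³ + e₄ Y⁴`. -/
def theta (kx ky : ℝ) (e : Fin 4 → ℝ) (h : Fin 4 → Fin 13 → ℝ) : Fin 4 → Fin 13 → ℝ :=
  ![shift kx ky (e 0) (h 0),
    shift kx ky (e 0) (h 1) + e 1 • h 0,
    shift kx ky (e 0) (h 2) + e 1 • h 1 + e 2 • h 0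
      - (1/12 : ℝ) • shift kx ky (e 0) (shift kx ky (e 0) (shift kx ky (e 0) (h 0))),
    shift kx ky (e 0) (h 3) + e 1 • h 2 + e 2 • h 1 + e 3 • h 0
      - (1/12 : ℝ) • shift kx ky (e 0) (shift kx ky (e 0) (shift kx ky (e 0) (h 1)))
      - (e 1 / 4) • shift kx ky (e 0) (shift kx ky (e 0) (h 0))]

/-- `h₀ + h₁ Y + h₂ Y² + h₃ Y³` is the expansion of the mean of the moments before and after the
collision, for an eigenmode whose eigenvalue has the coefficients `e`. -/
structure IsMode (sig : Fin 13 → ℝ) (eq : (Fin 13 → ℝ) → Fin 13 → ℝ) (kx ky : ℝ) (e : Fin 4 → ℝ)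
    (h : Fin 4 → Fin 13 → ℝ) : Prop where
  zero : h 0 = eq (h 0)
  succ : ∀ n : Fin 3, h n.succ = eq (h n.succ) + sig * theta kx ky e h n.castSucc
  conserved : ∀ n, ∀ i : Fin 4, theta kx ky e h n (i.castLE (by norm_num)) = 0

/-! ### Longitudinal modes: symmetric profiles -/

/-- The profiles of a longitudinal mode at the orders 0, 1, 2, 3: scalar moments, then vectors
along `k`, and tensors. -/
def profile0 (kx ky v : ℝ) (x : Fin 7 → ℝ) : Fin 13 → ℝ :=
  ![v * x 0, kx * x 1, ky * x 1, v * x 2, 0, 0, kx * x 3, ky * x 3, kx * x 4, ky * x 4,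
    v * x 5, v * x 6, 0]

/-- The profile of a longitudinal mode at the order 1. -/
def profile1 (kx ky v : ℝ) (x : Fin 10 → ℝ) : Fin 13 → ℝ :=
  ![(kx ^ 2 + ky ^ 2) * x 0, v * kx * x 1, v * ky * x 1, (kx ^ 2 + ky ^ 2) * x 2,
    (kx ^ 2 - ky ^ 2) * x 3, kx * ky * x 4, v * kx * x 5, v * ky * x 5, v * kx * x 6,
    v * ky * x 6, (kx ^ 2 + ky ^ 2) * x 7, (kx ^ 2 + ky ^ 2) * x 8, (kx ^ 2 - ky ^ 2) * x 9]

/-- The profile of a longitudinal mode at the order 2. -/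
def profile2 (kx ky v : ℝ) (x : Fin 13 → ℝ) : Fin 13 → ℝ :=
  ![v * (kx ^ 2 + ky ^ 2) * x 0, kx * (kx ^ 2 * x 1 + ky ^ 2 * x 2),
    ky * (ky ^ 2 * x 1 + kx ^ 2 * x 2), v * (kx ^ 2 + ky ^ 2) * x 3,
    v * (kx ^ 2 - ky ^ 2) * x 4, v * (kx * ky) * x 5,
    kx * (kx ^ 2 * x 6 + ky ^ 2 * x 7), ky * (ky ^ 2 * x 6 + kx ^ 2 * x 7),
    kx * (kx ^ 2 * x 8 + ky ^ 2 * x 9), ky * (ky ^ 2 * x 8 + kx ^ 2 * x 9),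
    v * (kx ^ 2 + ky ^ 2) * x 10, v * (kx ^ 2 + ky ^ 2) * x 11, v * (kx ^ 2 - ky ^ 2) * x 12]

/-- The profile of a longitudinal mode at the order 3. -/
def profile3 (kx ky v : ℝ) (x : Fin 17 → ℝ) : Fin 13 → ℝ :=
  ![(kx ^ 4 + ky ^ 4) * x 0 + kx ^ 2 * ky ^ 2 * x 1,
    v * kx * (kx ^ 2 * x 2 + ky ^ 2 * x 3), v * ky * (ky ^ 2 * x 2 + kx ^ 2 * x 3),
    (kx ^ 4 + ky ^ 4) * x 4 + kx ^ 2 * ky ^ 2 * x 5,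
    (kx ^ 4 - ky ^ 4) * x 6, kx * ky * (kx ^ 2 + ky ^ 2) * x 7,
    v * kx * (kx ^ 2 * x 8 + ky ^ 2 * x 9), v * ky * (ky ^ 2 * x 8 + kx ^ 2 * x 9),
    v * kx * (kx ^ 2 * x 10 + ky ^ 2 * x 11), v * ky * (ky ^ 2 * x 10 + kx ^ 2 * x 11),
    (kx ^ 4 + ky ^ 4) * x 12 + kx ^ 2 * ky ^ 2 * x 13,
    (kx ^ 4 + ky ^ 4) * x 14 + kx ^ 2 * ky ^ 2 * x 15,
    (kx ^ 4 - ky ^ 4) * x 16]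

/-- The conserved moments of a profile of order 4. -/
def profile4 (kx ky v : ℝ) (x : Fin 7 → ℝ) : Fin 4 → ℝ :=
  ![v * ((kx ^ 4 + ky ^ 4) * x 0 + kx ^ 2 * ky ^ 2 * x 1),
    kx * (kx ^ 4 * x 4 + kx ^ 2 * ky ^ 2 * x 5 + ky ^ 4 * x 6),
    ky * (ky ^ 4 * x 4 + kx ^ 2 * ky ^ 2 * x 5 + kx ^ 4 * x 6),
    v * ((kx ^ 4 + ky ^ 4) * x 2 + kx ^ 2 * ky ^ 2 * x 3)]

/-- The operator `shift` on the coefficients of the profiles. -/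
def shift0 (de g : ℝ) (x : Fin 7 → ℝ) : Fin 10 → ℝ :=
  ![x 1 + g * x 0, 14/13 * x 0 + 1/26 * x 2 + de * x 1, 11 * x 1 + 13 * x 3 + g * x 2,
    17/7 * x 1 + 7/5 * x 3 + 12/35 * x 4, 2 * (2/7 * x 1 - 1/5 * x 3 - 6/35 * x 4),
    5/77 * x 2 + 1/77 * x 5 + de * x 3, 3/137 * x 5 + 35/137 * x 6 + de * x 4,
    137/5 * x 3 + 66/5 * x 4 + g * x 5, 2 * x 4 + g * x 6, 6/5 * x 3 - 2/5 * x 4]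

/-- The action of `shift` on the coefficients of `profile1`. -/
def shift1 (de g : ℝ) (x : Fin 10 → ℝ) : Fin 13 → ℝ :=
  ![x 1 + de * x 0,
    14/13 * x 0 + 1/26 * x 2 + 1/2 * x 3 + g * x 1,
    14/13 * x 0 + 1/26 * x 2 - 1/2 * x 3 + x 4 + g * x 1,
    11 * x 1 + 13 * x 5 + de * x 2,
    17/7 * x 1 + 7/5 * x 5 + 12/35 * x 6 + de * x 3,
    2 * (2/7 * x 1 - 1/5 * x 5 - 6/35 * x 6) + de * x 4,
    5/77 * x 2 + 1/77 * x 7 + 7/17 * x 3 + 6/17 * x 9 + g * x 5,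
    5/77 * x 2 + 1/77 * x 7 - 7/17 * x 3 - 6/17 * x 9 - x 4 + g * x 5,
    3/137 * x 7 + 35/137 * x 8 + 6/17 * x 3 - 7/17 * x 9 + g * x 6,
    3/137 * x 7 + 35/137 * x 8 - 6/17 * x 3 + 7/17 * x 9 - 3 * x 4 + g * x 6,
    137/5 * x 5 + 66/5 * x 6 + de * x 7, 2 * x 6 + de * x 8, 6/5 * x 5 - 2/5 * x 6 + de * x 9]

/-- The action of `shift` on the coefficients of `profile2`. -/
def shift2 (de g : ℝ) (x : Fin 13 → ℝ) : Fin 17 → ℝ :=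
  ![x 1 + g * x 0, 2 * x 2 + 2 * g * x 0,
    14/13 * x 0 + 1/26 * x 3 + 1/2 * x 4 + de * x 1,
    14/13 * x 0 + 1/26 * x 3 - 1/2 * x 4 + x 5 + de * x 2,
    11 * x 1 + 13 * x 6 + g * x 3, 2 * (11 * x 2 + 13 * x 7) + 2 * g * x 3,
    17/7 * x 1 + 7/5 * x 6 + 12/35 * x 8 + g * x 4,
    2/7 * (x 1 + x 2) - 1/5 * (x 6 + x 7) - 6/35 * (x 8 + x 9) + g * x 5,
    5/77 * x 3 + 1/77 * x 10 + 7/17 * x 4 + 6/17 * x 12 + de * x 6,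
    5/77 * x 3 + 1/77 * x 10 - 7/17 * x 4 - 6/17 * x 12 - x 5 + de * x 7,
    3/137 * x 10 + 35/137 * x 11 + 6/17 * x 4 - 7/17 * x 12 + de * x 8,
    3/137 * x 10 + 35/137 * x 11 - 6/17 * x 4 + 7/17 * x 12 - 3 * x 5 + de * x 9,
    137/5 * x 6 + 66/5 * x 8 + g * x 10, 2 * (137/5 * x 7 + 66/5 * x 9) + 2 * g * x 10,
    2 * x 8 + g * x 11, 4 * x 9 + 2 * g * x 11, 6/5 * x 6 - 2/5 * x 8 + g * x 12]

/-- The action of `shift` on the coefficients of `profile3`. -/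
def shift3 (de g : ℝ) (x : Fin 17 → ℝ) : Fin 7 → ℝ :=
  ![x 2 + de * x 0, 2 * x 3 + de * x 1, 11 * x 2 + 13 * x 8 + de * x 4,
    2 * (11 * x 3 + 13 * x 9) + de * x 5,
    14/13 * x 0 + 1/26 * x 4 + 1/2 * x 6 + g * x 2,
    14/13 * x 1 + 1/26 * x 5 + x 7 + g * (x 2 + x 3),
    14/13 * x 0 + 1/26 * x 4 - 1/2 * x 6 + x 7 + g * x 3]

section profiles

variable {kx ky v e de g : ℝ}

/-- The scalar `v` is the odd factor: `v = e` for an acoustic wave, and `v = 1`, `e = 0` for the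
thermal mode. Multiplication by `e` either creates the factor `v` (through `he`) or trades it for
`kx² + ky²` (through `hg`), so the shape of the profiles is preserved. -/
theorem shift_profile0 (he : e = de * v) (hg : e * v = g * (kx ^ 2 + ky ^ 2)) (x : Fin 7 → ℝ) :
    shift kx ky e (profile0 kx ky v x) = profile1 kx ky v (shift0 de g x) := by
  ext i
  fin_cases i <;> simp [shift, advect, profile0, profile1, shift0]
  all_goals first
    | ring1
    | grind

theorem shift_profile1 (he : e = de * v) (hg : e * v = g * (kx ^ 2 + ky ^ 2)) (x : Fin 10 → ℝ) :
    shift kx ky e (profile1 kx ky v x) = profile2 kx ky v (shift1 de g x) := by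
  ext i
  fin_cases i <;> simp [shift, advect, profile1, profile2, shift1]
  all_goals first
    | ring1
    | grind

theorem shift_profile2 (he : e = de * v) (hg : e * v = g * (kx ^ 2 + ky ^ 2)) (x : Fin 13 → ℝ) :
    shift kx ky e (profile2 kx ky v x) = profile3 kx ky v (shift2 de g x) := by
  ext i
  fin_cases i <;> simp [shift, advect, profile2, profile3, shift2]
  all_goals first
    | ring1
    | grind

theorem shift_profile3 (he : e = de * v) (hg : e * v = g * (kx ^ 2 + ky ^ 2)) (x : Fin 17 → ℝ)
    (i : Fin 4) :
    shift kx ky e (profile3 kx ky v x) (i.castLE (by norm_num))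
      = profile4 kx ky v (shift3 de g x) i := by
  fin_cases i <;> simp [shift, advect, profile3, profile4, shift3]
  all_goals first
    | ring1
    | grind

end profiles

/-- The data of a longitudinal mode: the coefficients `s, t, s11, s12` of dissipation and
`al2, be2, al3, be3` of equilibrium, the coefficients `de, g, a, b, bg, d` of the eigenvalue, and
the conserved moments of the orders 0 to 3. -/
structure Longitudinal where
  s : ℝ
  t : ℝ
  s11 : ℝ
  s12 : ℝ
  al2 : ℝ
  be2 : ℝ
  al3 : ℝ
  be3 : ℝ
  de : ℝ
  g : ℝ
  a : ℝ
  b : ℝ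
  bg : ℝ
  d : ℝ
  r0 : ℝ
  j0 : ℝ
  E0 : ℝ
  j1 : ℝ
  E1 : ℝ
  j2 : ℝ
  E2 : ℝ
  r3 : ℝ
  jA : ℝ
  jB : ℝ
  EA : ℝ
  EB : ℝ

namespace Longitudinal

variable (m : Longitudinal)

/-- The coefficients of the profile of order 0. -/
def x0 : Fin 7 → ℝ :=
  ![m.r0, m.j0, m.E0, -7/5 * m.j0, 29/30 * m.j0, m.al2 * m.r0 + m.be2 * m.E0,
    m.al3 * m.r0 + m.be3 * m.E0]

/-- The coefficients of `theta` at order 1. -/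
def y1 : Fin 10 → ℝ := shift0 m.de m.g m.x0

theorem shift0_x0 : shift0 m.de m.g m.x0 = m.y1 := rfl

/-- The coefficients of the profile of order 1. -/
def x1 : Fin 10 → ℝ :=
  ![0, m.j1, m.E1, m.s * m.y1 3, m.s * m.y1 4, -7/5 * m.j1 + m.t * m.y1 5,
    29/30 * m.j1 + m.t * m.y1 6, m.be2 * m.E1 + m.s11 * m.y1 7, m.be3 * m.E1 + m.s12 * m.y1 8,
    m.s * m.y1 9]

/-- The coefficients of `theta` at order 2. -/
def y2 : Fin 13 → ℝ := fun i =>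
  shift1 m.de m.g m.x1 i + m.a * (![m.x0 0, m.x0 1, m.x0 1, m.x0 2, 0, 0, m.x0 3, m.x0 3, m.x0 4,
    m.x0 4, m.x0 5, m.x0 6, 0] : Fin 13 → ℝ) i

/-- The coefficients of the profile of order 2. -/
def x2 : Fin 13 → ℝ :=
  ![0, m.j2, m.j2, m.E2, m.s * m.y2 4, m.s * m.y2 5, -7/5 * m.j2 + m.t * m.y2 6,
    -7/5 * m.j2 + m.t * m.y2 7, 29/30 * m.j2 + m.t * m.y2 8, 29/30 * m.j2 + m.t * m.y2 9,
    m.be2 * m.E2 + m.s11 * m.y2 10, m.be3 * m.E2 + m.s12 * m.y2 11, m.s * m.y2 12]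

/-- The coefficients of `theta` at order 3. -/
def y3 : Fin 17 → ℝ := fun i =>
  shift2 m.de m.g m.x2 i
    -- The factors 2 come from `(kx² + ky²)² = kx⁴ + ky⁴ + 2 kx² ky²`: an isotropic scalar of degree
    -- four has mixed coefficient twice the pure one.
    + m.a * (![m.x1 0, 2 * m.x1 0, m.x1 1, m.x1 1, m.x1 2, 2 * m.x1 2, m.x1 3, m.x1 4, m.x1 5,
        m.x1 5, m.x1 6, m.x1 6, m.x1 7, 2 * m.x1 7, m.x1 8, 2 * m.x1 8, m.x1 9] : Fin 17 → ℝ) i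
    + (![m.bg * m.x0 0, 2 * m.bg * m.x0 0, m.b * m.x0 1, m.b * m.x0 1, m.bg * m.x0 2,
        2 * m.bg * m.x0 2, 0, 0, m.b * m.x0 3, m.b * m.x0 3, m.b * m.x0 4, m.b * m.x0 4,
        m.bg * m.x0 5, 2 * m.bg * m.x0 5, m.bg * m.x0 6, 2 * m.bg * m.x0 6, 0] : Fin 17 → ℝ) i
    - 1/12 * shift2 m.de m.g (shift1 m.de m.g m.y1) i

/-- The coefficients of the profile of order 3. -/
def x3 : Fin 17 → ℝ :=
  ![0, m.r3, m.jA, m.jB, m.EA, m.EB, m.s * m.y3 6, m.s * m.y3 7, -7/5 * m.jA + m.t * m.y3 8,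
    -7/5 * m.jB + m.t * m.y3 9, 29/30 * m.jA + m.t * m.y3 10, 29/30 * m.jB + m.t * m.y3 11,
    m.be2 * m.EA + m.s11 * m.y3 12, m.al2 * m.r3 + m.be2 * m.EB + m.s11 * m.y3 13,
    m.be3 * m.EA + m.s12 * m.y3 14, m.al3 * m.r3 + m.be3 * m.EB + m.s12 * m.y3 15, m.s * m.y3 16]

/-- The coefficients of the conserved part of `theta` at order 4. -/
def y4 : Fin 7 → ℝ := fun i =>
  shift3 m.de m.g m.x3 i
    + m.a * (![m.x2 0, 2 * m.x2 0, m.x2 3, 2 * m.x2 3, m.x2 1, m.x2 1 + m.x2 2, m.x2 2] :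
        Fin 7 → ℝ) i
    + (![m.b * m.x1 0, 2 * m.b * m.x1 0, m.b * m.x1 2, 2 * m.b * m.x1 2, m.bg * m.x1 1,
        2 * m.bg * m.x1 1, m.bg * m.x1 1] : Fin 7 → ℝ) i
    + m.d * (![m.x0 0, 2 * m.x0 0, m.x0 2, 2 * m.x0 2, m.x0 1, 2 * m.x0 1, m.x0 1] :
        Fin 7 → ℝ) i
    - 1/12 * shift3 m.de m.g (shift2 m.de m.g (shift1 m.de m.g m.x1)) i
    - m.a / 4 * (![shift1 m.de m.g m.y1 0, 2 * shift1 m.de m.g m.y1 0, shift1 m.de m.g m.y1 3,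
        2 * shift1 m.de m.g m.y1 3, shift1 m.de m.g m.y1 1,
        shift1 m.de m.g m.y1 1 + shift1 m.de m.g m.y1 2, shift1 m.de m.g m.y1 2] : Fin 7 → ℝ) i

/-- The coefficients of the eigenvalue. -/
def eigen (kx ky v e : ℝ) : Fin 4 → ℝ :=
  ![e, m.a * (kx ^ 2 + ky ^ 2), m.b * v * (kx ^ 2 + ky ^ 2), m.d * (kx ^ 2 + ky ^ 2) ^ 2]

/-- The expansion of the mode. -/
def expansion (kx ky v : ℝ) : Fin 4 → Fin 13 → ℝ :=
  ![profile0 kx ky v m.x0, profile1 kx ky v m.x1, profile2 kx ky v m.x2, profile3 kx ky v m.x3]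

section

variable {m} {kx ky v e : ℝ}

theorem theta_one (he : e = m.de * v) (hg : e * v = m.g * (kx ^ 2 + ky ^ 2)) :
    theta kx ky (m.eigen kx ky v e) (m.expansion kx ky v) 0 = profile1 kx ky v m.y1 := by
  simp only [theta, expansion, eigen, Matrix.cons_val_zero]
  exact shift_profile0 he hg _

theorem theta_two (he : e = m.de * v) (hg : e * v = m.g * (kx ^ 2 + ky ^ 2)) :
    theta kx ky (m.eigen kx ky v e) (m.expansion kx ky v) 1 = profile2 kx ky v m.y2 := by
  simp only [theta, expansion, eigen, Matrix.cons_val_zero, Matrix.cons_val_one,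
    shift_profile1 he hg]
  unfold y2
  generalize shift1 m.de m.g m.x1 = z
  ext i
  fin_cases i <;> simp [profile0, profile2] <;> ring

theorem theta_three (he : e = m.de * v) (hg : e * v = m.g * (kx ^ 2 + ky ^ 2))
    (hb : m.b * v * v = m.bg * (kx ^ 2 + ky ^ 2)) :
    theta kx ky (m.eigen kx ky v e) (m.expansion kx ky v) 2 = profile3 kx ky v m.y3 := by
  simp only [theta, expansion, eigen, Matrix.cons_val_zero, Matrix.cons_val_one, Matrix.cons_val,
    shift_profile0 he hg, shift_profile1 he hg, shift_profile2 he hg, shift0_x0]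
  unfold y3
  generalize shift2 m.de m.g m.x2 = z
  generalize shift2 m.de m.g _ = z'
  ext i
  fin_cases i <;> simp [profile0, profile1, profile3]
  all_goals first
    | ring1
    -- Scalar components carry a factor `v`; with the `v` in the third coefficient of the eigenvalue
    -- it gives `v²`, removed by `hb`.
    | linear_combination (kx ^ 2 + ky ^ 2) * m.x0 0 * hb
    | linear_combination (kx ^ 2 + ky ^ 2) * m.x0 2 * hb
    | linear_combination (kx ^ 2 + ky ^ 2) * m.x0 5 * hb
    | linear_combination (kx ^ 2 + ky ^ 2) * m.x0 6 * hb

theorem theta_four (he : e = m.de * v) (hg : e * v = m.g * (kx ^ 2 + ky ^ 2))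
    (hb : m.b * v * v = m.bg * (kx ^ 2 + ky ^ 2)) (i : Fin 4) :
    theta kx ky (m.eigen kx ky v e) (m.expansion kx ky v) 3 (i.castLE (by norm_num))
      = profile4 kx ky v m.y4 i := by
  simp only [theta, expansion, eigen, Matrix.cons_val_zero, Matrix.cons_val_one, Matrix.cons_val,
    shift_profile0 he hg, shift_profile1 he hg, shift_profile2 he hg, Pi.add_apply,
    Pi.sub_apply, Pi.smul_apply, shift_profile3 he hg, shift0_x0]
  unfold y4
  generalize shift3 m.de m.g m.x3 = z
  generalize shift3 m.de m.g _ = z'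
  generalize shift1 m.de m.g m.y1 = z''
  fin_cases i <;> simp [profile0, profile1, profile2, profile4]
  all_goals first
    | ring1
    | linear_combination kx * (kx ^ 2 + ky ^ 2) * m.x1 1 * hb
    | linear_combination ky * (kx ^ 2 + ky ^ 2) * m.x1 1 * hb

/-- The profiles form an eigenmode if the conserved part of `theta` vanishes. -/
theorem isMode (he : e = m.de * v) (hg : e * v = m.g * (kx ^ 2 + ky ^ 2))
    (hb : m.b * v * v = m.bg * (kx ^ 2 + ky ^ 2))
    (h1 : ∀ i : Fin 3, m.y1 (i.castLE (by norm_num)) = 0)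
    (h2 : ∀ i : Fin 4, m.y2 (i.castLE (by norm_num)) = 0)
    (h3 : ∀ i : Fin 6, m.y3 (i.castLE (by norm_num)) = 0) (h4 : m.y4 = 0) :
    IsMode (dissipation m.s m.t m.s11 m.s12) (equil m.al2 m.be2 m.al3 m.be3) kx ky
      (m.eigen kx ky v e) (m.expansion kx ky v) := by
  -- The first two conditions hold by construction, since the nonconserved entries of `x0`, …, `x3`
  -- are defined as equilibrium plus `σ θ`. Only conservation uses `h1` to `h4`, whose index ranges
  -- are exactly the coefficients of density, momentum and energy.
  refine ⟨?_, fun n => ?_, fun n i => ?_⟩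
  · ext i
    fin_cases i <;> simp [expansion, profile0, equil, x0] <;> ring
  · fin_cases n
    · show m.expansion kx ky v 1 = equil _ _ _ _ (m.expansion kx ky v 1) + _ * theta _ _ _ _ 0
      rw [theta_one he hg]
      ext i
      fin_cases i <;> simp [expansion, profile1, equil, x1, dissipation] <;> ring
    · show m.expansion kx ky v 2 = equil _ _ _ _ (m.expansion kx ky v 2) + _ * theta _ _ _ _ 1
      rw [theta_two he hg]
      ext i
      fin_cases i <;> simp [expansion, profile2, equil, x2, dissipation] <;> ring
    · show m.expansion kx ky v 3 = equil _ _ _ _ (m.expansion kx ky v 3) + _ * theta _ _ _ _ 2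
      rw [theta_three he hg hb]
      ext i
      fin_cases i <;> simp [expansion, profile3, equil, x3, dissipation] <;> ring
  · simp only [Fin.forall_fin_succ] at h1 h2 h3
    fin_cases n
    · show theta _ _ _ _ 0 _ = 0
      rw [theta_one he hg]
      fin_cases i <;> simp_all [profile1]
    · show theta _ _ _ _ 1 _ = 0
      rw [theta_two he hg]
      fin_cases i <;> simp_all [profile2]
    · show theta _ _ _ _ 2 _ = 0
      rw [theta_three he hg hb]
      fin_cases i <;> simp_all [profile3]
    · show theta _ _ _ _ 3 _ = 0
      rw [theta_four he hg hb, h4]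
      fin_cases i <;> simp [profile4]

end

end Longitudinal

/-! ### The shear mode -/

/-- The transverse moments of the shear mode, and their images under the powers of `advect`. -/
def shear0 (kx ky : ℝ) : Fin 13 → ℝ :=
  ![0, -ky, kx, 0, 0, 0, 7/5 * ky, -7/5 * kx, -29/30 * ky, 29/30 * kx, 0, 0, 0]

/-- The image of `shear0` under `advect`. -/
def shear1 (kx ky : ℝ) : Fin 13 → ℝ :=
  ![0, 0, 0, 0, -8/5 * kx * ky, 2/5 * (kx ^ 2 - ky ^ 2), 0, 0, 0, 0, 0, 0, 62/15 * kx * ky]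

/-- The image of `shear1` under `advect`. -/
def shear2 (kx ky : ℝ) : Fin 13 → ℝ :=
  ![0, -2/5 * ky * (kx ^ 2 + ky ^ 2), 2/5 * kx * (kx ^ 2 + ky ^ 2), 0, 0, 0,
    2/5 * ky * (kx ^ 2 + ky ^ 2), -2/5 * kx * (kx ^ 2 + ky ^ 2),
    ky * (-52/15 * kx ^ 2 + 6/5 * ky ^ 2), kx * (-6/5 * kx ^ 2 + 52/15 * ky ^ 2), 0, 0, 0]

/-- The image of `shear2` under `advect`. -/
def shear3 (kx ky : ℝ) : Fin 13 → ℝ :=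
  ![0, 0, 0, 0, -8/5 * kx * ky * (kx ^ 2 + ky ^ 2), 2/5 * (kx ^ 4 - ky ^ 4), 0, 0, 0, 0,
    -308/5 * kx * ky * (kx ^ 2 - ky ^ 2), -28/3 * kx * ky * (kx ^ 2 - ky ^ 2),
    28/15 * kx * ky * (kx ^ 2 + ky ^ 2)]

/-- The shear mode at order 2. -/
def shearProfile2 (kx ky : ℝ) : Fin 13 → ℝ :=
  ![0, 0, 0, 0, 0, 0, -1/75 * ky * (kx ^ 2 + ky ^ 2), 1/75 * kx * (kx ^ 2 + ky ^ 2),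
    ky * (-77/300 * kx ^ 2 + 119/900 * ky ^ 2), kx * (-119/900 * kx ^ 2 + 77/300 * ky ^ 2),
    0, 0, 0]

/-- The shear mode at order 3. -/
def shearProfile3 (s kx ky : ℝ) : Fin 13 → ℝ :=
  ![0, 0, 0, 0, (16/25 * s ^ 3 + 4/75 * s) * kx * ky * (kx ^ 2 + ky ^ 2),
    -(4/25 * s ^ 3 + 1/75 * s) * (kx ^ 4 - ky ^ 4), 0, 0, 0, 0, 0, 0,
    -(124/75 * s ^ 3 + 31/225 * s) * kx * ky * (kx ^ 2 + ky ^ 2)]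

section shear

variable (s kx ky : ℝ)

theorem shift_shear0 : shift kx ky 0 (shear0 kx ky) = shear1 kx ky := by
  ext i
  fin_cases i <;> simp [shift, advect, shear0, shear1] <;> ring1

theorem shift_shear1 : shift kx ky 0 (s • shear1 kx ky) = s • shear2 kx ky := by
  ext i
  fin_cases i <;> simp [shift, advect, shear1, shear2] <;> ring1

theorem shift_shear2 : shift kx ky 0 (s • shear2 kx ky) = s • shear3 kx ky := by
  ext i
  fin_cases i <;> simp [shift, advect, shear2, shear3] <;> ring1

/-- The coefficients of the shear eigenvalue. -/
def shearEigen : Fin 4 → ℝ :=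
  ![0, -2/5 * s * (kx ^ 2 + ky ^ 2), 0, (4/25 * s ^ 3 + 1/150 * s) * (kx ^ 2 + ky ^ 2) ^ 2]

/-- The expansion of the shear mode. -/
def shearExpansion : Fin 4 → Fin 13 → ℝ :=
  ![shear0 kx ky, s • shear1 kx ky, shearProfile2 kx ky, shearProfile3 s kx ky]

theorem theta_shear :
    theta kx ky (shearEigen s kx ky) (shearExpansion s kx ky) =
      ![shear1 kx ky,
        s • shear2 kx ky + (-2/5 * s * (kx ^ 2 + ky ^ 2)) • shear0 kx ky,
        shift kx ky 0 (shearProfile2 kx ky)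
          + (-2/5 * s * (kx ^ 2 + ky ^ 2)) • s • shear1 kx ky - (1/12 : ℝ) • shear3 kx ky,
        shift kx ky 0 (shearProfile3 s kx ky)
          + (-2/5 * s * (kx ^ 2 + ky ^ 2)) • shearProfile2 kx ky
          + ((4/25 * s ^ 3 + 1/150 * s) * (kx ^ 2 + ky ^ 2) ^ 2) • shear0 kx ky
          - (1/12 : ℝ) • shift kx ky 0 (s • shear3 kx ky)
          - (-2/5 * s * (kx ^ 2 + ky ^ 2) / 4) • shear2 kx ky] := by
  have h1 := shift_shear1 1 kx ky
  have h2 := shift_shear2 1 kx ky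
  simp only [one_smul] at h1 h2
  simp only [theta, shearEigen, shearExpansion, Matrix.cons_val, shift_shear0, shift_shear1,
    shift_shear2, h1, h2, zero_smul, add_zero]

variable {s kx ky}

set_option maxHeartbeats 1000000 in
-- The coefficients of `shearProfile2` already contain `s t = 1/12`. With this value the `E₂` and
-- `E₃` entries of the jump at order 3 cancel against `shear3 / 12`, so neither `s11`, `s12` nor the
-- equilibria of `E₂`, `E₃` influence the mode.
theorem isMode_shear {t s11 s12 al2 be2 al3 be3 : ℝ} (hst : 12 * s * t = 1) :
    IsMode (dissipation s t s11 s12) (equil al2 be2 al3 be3) kx ky (shearEigen s kx ky)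
      (shearExpansion s kx ky) := by
  refine ⟨?_, fun n => ?_, fun n i => ?_⟩
  · ext i
    fin_cases i <;> simp [shearExpansion, shear0, equil] <;> grind
  · rw [theta_shear]
    fin_cases n
    · ext i
      fin_cases i <;> simp [shearExpansion, equil, dissipation, shear1]
    · show shearProfile2 kx ky = equil _ _ _ _ (shearProfile2 kx ky) + _ * (s • shear2 kx ky + _)
      ext i
      fin_cases i <;> simp [shearProfile2, equil, dissipation, shear0, shear2]
      all_goals grind
    · show shearProfile3 s kx ky
        = equil _ _ _ _ (shearProfile3 s kx ky) + _ * (shift kx ky 0 (shearProfile2 kx ky) + _ - _)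
      ext i
      fin_cases i <;>
        simp [shearProfile3, shearProfile2, equil, dissipation, shear1, shear3, shift, advect]
      all_goals grind
  · rw [theta_shear]
    fin_cases n
    · fin_cases i <;> simp [shear1]
    · fin_cases i <;> simp [shear0, shear2] <;> ring1
    · fin_cases i <;> simp [shear1, shear3, shearProfile2, shift, advect] <;> ring1
    · fin_cases i <;>
        simp [shear0, shear2, shear3, shearProfile2, shearProfile3, shift, advect] <;> ring1

end shear

/-! ### Conservation equations of the acoustic and thermal modes -/

namespace Longitudinal

/-- The conserved part of `theta` at order 4, apart from the terms that come from the conserved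
moments at order 3 and from the eigenvalue at order 4. -/
def residual (m : Longitudinal) : Fin 7 → ℝ :=
  { m with r3 := 0, jA := 0, jB := 0, EA := 0, EB := 0, d := 0 }.y4

/-- At order 4 the unknowns `r3, jA, jB, EA, EB, d` enter affinely. Isolating their linear part
reduces order 4 to a solvability question for `residual`. -/
theorem y4_eq (m : Longitudinal) :
    m.y4 = fun i => m.residual i +
      (![m.jA + m.r0 * m.d, 2 * m.jB + m.de * m.r3 + 2 * m.r0 * m.d,
        -36/5 * m.jA + m.de * m.EA + m.E0 * m.d,
        2 * (-36/5 * m.jB) + m.de * m.EB + 2 * m.E0 * m.d,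
        1/26 * m.EA + m.g * m.jA + m.j0 * m.d,
        14/13 * m.r3 + 1/26 * m.EB + m.g * (m.jA + m.jB) + 2 * m.j0 * m.d,
        1/26 * m.EA + m.g * m.jB + m.j0 * m.d] : Fin 7 → ℝ) i := by
  have h3 (i) : { m with r3 := 0, jA := 0, jB := 0, EA := 0, EB := 0, d := 0 }.y3 i = m.y3 i := rfl
  have h2 (i) : { m with r3 := 0, jA := 0, jB := 0, EA := 0, EB := 0, d := 0 }.x2 i = m.x2 i := rfl
  have h1 (i) : { m with r3 := 0, jA := 0, jB := 0, EA := 0, EB := 0, d := 0 }.x1 i = m.x1 i := rfl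
  have hy : { m with r3 := 0, jA := 0, jB := 0, EA := 0, EB := 0, d := 0 }.y1 = m.y1 := rfl
  have hx : { m with r3 := 0, jA := 0, jB := 0, EA := 0, EB := 0, d := 0 }.x1 = m.x1 := rfl
  unfold residual y4
  simp only [h1, h2, hy, hx]
  generalize shift3 m.de m.g (shift2 m.de m.g (shift1 m.de m.g m.x1)) = z
  generalize shift1 m.de m.g m.y1 = z'
  ext i
  fin_cases i <;> simp [shift3, x3, x0, h3] <;> ring1

end Longitudinal

namespace Longitudinal

/-- An acoustic mode, up to the conserved moments at order 3 and the eigenvalue at order 4. -/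
def acoustic (s t s11 s12 al2 be2 al3 be3 a j1 E1 b j2 E2 : ℝ) : Longitudinal :=
  ⟨s, t, s11, s12, al2, be2, al3, be3, 1, 4/5, a, b, 4/5 * b, 0, 1, -4/5, -36/5,
    j1, E1, j2, E2, 0, 0, 0, 0, 0⟩

/-- The thermal mode, up to the conserved moments at order 3 and the eigenvalue at order 4. -/
def thermal (s t s11 s12 al2 be2 al3 be3 a E2 : ℝ) : Longitudinal :=
  ⟨s, t, s11, s12, al2, be2, al3, be3, 0, 0, a, 0, 0, 0, 1, 0, -28,
    -a, 0, 0, E2, 0, 0, 0, 0, 0⟩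

section

variable {s t s11 s12 al2 be2 al3 be3 a j1 E1 b j2 E2 : ℝ}

theorem y1_acoustic (i : Fin 3) :
    (acoustic s t s11 s12 al2 be2 al3 be3 a j1 E1 b j2 E2).y1 (i.castLE (by norm_num)) = 0 := by
  fin_cases i <;> simp [acoustic, y1, shift0, x0] <;> norm_num

theorem y2_acoustic (h0 : a + j1 = 0)
    (h1 : -8/25 * s - 4/5 * a + 4/5 * j1 + 1/26 * E1 = 0)
    (h3 : 13/77 * t * al2 - 468/385 * t * be2 + 16328/1925 * t - 36/5 * a - 36/5 * j1 + E1 = 0)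
    (i : Fin 4) :
    (acoustic s t s11 s12 al2 be2 al3 be3 a j1 E1 b j2 E2).y2 (i.castLE (by norm_num)) = 0 := by
  fin_cases i <;> simp [acoustic, y2, shift1, x1, y1, shift0, x0]
  · linear_combination h0
  · linear_combination h1
  · linear_combination h1
  · linear_combination h3

set_option maxHeartbeats 1000000 in
-- Third-order isotropy: the momentum coefficients of `kx³` and `kx ky²` must agree, and they differ
-- by a multiple of `12 s t - 1`. The mass and energy equations lead to one condition each.
theorem y3_acoustic (hst : 12 * s * t = 1) (h0 : 4/5 * b + j2 + 2/75 = 0)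
    (h2 : -8/25 * s ^ 2 + 2/5 * s * j1 - 1/1848 * al2 + 3/770 * be2 + a * j1 - 4/5 * b + j2 + 1/26
      * E2 + 151/5775 = 0)
    (h4 : 52/385 * t ^ 2 * al2 - 1872/1925 * t ^ 2 * be2 + 65312/9625 * t ^ 2 + 52/385 * t * al2 *
      s11 - 1872/1925 * t * be2 * s11 + 13/77 * t * be2 * E1 + 6656/1925 * t * s11 + 364/25 * t
      * a - 364/25 * t * j1 + 65/77 * t * E1 - 13/385 * al2 + 468/1925 * be2 + a * E1 - 144/25
      * b - 36/5 * j2 + 4/5 * E2 - 32506/28875 = 0)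
    (i : Fin 6) :
    (acoustic s t s11 s12 al2 be2 al3 be3 a j1 E1 b j2 E2).y3 (i.castLE (by norm_num)) = 0 := by
  fin_cases i <;> simp [acoustic, y3, shift2, x2, y2, shift1, x1, y1, shift0, x0]
  · linear_combination h0
  · linear_combination 2 * h0
  · linear_combination h2 + (271/253176 * al2 - 813/105490 * be2 + 1/274 * al3 - 18/685 * be3 + 52/1925) * hst
  · linear_combination h2 + (-7/3288 * al2 + 21/1370 * be2 - 3/274 * al3 + 54/685 * be3 - 2/75) * hst
  · linear_combination h4 + 26/75 * hst
  · linear_combination 2 * h4 + 52/75 * hst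

set_option maxHeartbeats 4000000 in
-- The weights annihilate the linear part in `y4_eq` for the acoustic data, so this is the
-- compatibility condition of seven equations in six unknowns. `hB` is that condition reduced modulo
-- `hst`. It involves the equilibria only through `al2 - 36/5 be2` and `al3 - 36/5 be3`, the values
-- of `E₂` and `E₃` in the leading acoustic mode.
theorem residual_acoustic (hst : 12 * s * t = 1)
    (h1 : -8/25 * s - 4/5 * a + 4/5 * j1 + 1/26 * E1 = 0)
    (hB : (108/10549 * al2 - 3888/52745 * be2 + 32/685 * al3 - 1152/3425 * be3 + 992/5775) * s
      + (-59/126588 * al2 + 177/52745 * be2 + 7/685 * al3 - 252/3425 * be3 - 568/5775) * t = 0)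
    {C : Fin 7 → ℝ}
    (hC : C = (acoustic s t s11 s12 al2 be2 al3 be3 a j1 E1 b j2 E2).residual) :
    28/13 * C 0 - 14/13 * C 1 + 1/13 * C 2 - 1/26 * C 3 - 3 * C 4 + C 5 + C 6 = 0 := by
  subst hC
  simp [acoustic, residual, y4, shift3, x3, y3, shift2, x2, y2, shift1, x1, y1, shift0, x0]
  linear_combination hB + 13/42 * h1
    + (-54/10549 * s * al2 + 1944/52745 * s * be2 - 16/685 * s * al3 + 576/3425 * s * be3 -
      356/1925 * s - 127/31647 * t * al2 + 1524/52745 * t * be2 - 21/685 * t * al3 + 756/3425 *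
      t * be3 + 134/5775 * t - 54/10549 * al2 * s11 + 1944/52745 * be2 * s11 - 135/21098 * be2
      * E1 - 16/685 * al3 * s12 + 576/3425 * be3 * s12 - 4/137 * be3 * E1 - 6912/52745 * s11 +
      464/10275 * s12 - 26/105 * a + 26/105 * j1 - 3/154 * E1) * hst

theorem y1_thermal (i : Fin 3) :
    (thermal s t s11 s12 al2 be2 al3 be3 a E2).y1 (i.castLE (by norm_num)) = 0 := by
  fin_cases i <;> simp [thermal, y1, shift0, x0] <;> norm_num

theorem y2_thermal (h3 : 13/77 * t * al2 - 52/11 * t * be2 - 260/11 * t - 104/5 * a = 0) (i : Fin 4) :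
    (thermal s t s11 s12 al2 be2 al3 be3 a E2).y2 (i.castLE (by norm_num)) = 0 := by
  fin_cases i <;> simp [thermal, y2, shift1, x1, y1, shift0, x0]
  linear_combination h3

set_option maxHeartbeats 1000000 in
theorem y3_thermal (hst : 12 * s * t = 1)
    (h2 : -2/5 * s * a - 1/1848 * al2 + 1/66 * be2 - a ^ 2 + 1/26 * E2 + 5/66 = 0) (i : Fin 6) :
    (thermal s t s11 s12 al2 be2 al3 be3 a E2).y3 (i.castLE (by norm_num)) = 0 := by
  fin_cases i <;> simp [thermal, y3, shift2, x2, y2, shift1, x1, y1, shift0, x0]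
  · linear_combination h2 + (271/253176 * al2 - 271/9042 * be2 + 1/274 * al3 - 14/137 * be3 - 7/66) * hst
  · linear_combination h2 + (-7/3288 * al2 + 49/822 * be2 - 3/274 * al3 + 42/137 * be3 + 1/6) * hst

set_option maxHeartbeats 4000000 in
-- Eliminating `jA` and `jB` between mass and energy leaves two equations for `d`; the first
-- conclusion makes them agree. `hA` involves only `al2 - 28 be2` and `al3 - 28 be3`, because the
-- thermal mode has zero pressure `14/13 ρ + 1/26 E`, hence `E = -28 ρ`.
theorem residual_thermal (hst : 12 * s * t = 1)
    (hA : 1313/9042 * al2 - 18382/4521 * be2 + 234/685 * al3 - 6552/685 * be3 - 2678/165 = 0)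
    {C : Fin 7 → ℝ} (hC : C = (thermal s t s11 s12 al2 be2 al3 be3 a E2).residual) :
    C 3 + 36/5 * C 1 = 2 * (C 2 + 36/5 * C 0) ∧ C 4 = 0 ∧ C 5 = 0 ∧ C 6 = 0 := by
  subst hC
  simp [thermal, residual, y4, shift3, x3, y3, shift2, x2, y2, shift1, x1, y1, shift0, x0]
  linear_combination t * hA
    + (-130/4521 * t * al2 + 3640/4521 * t * be2 + 26/137 * t * al3 - 728/137 * t * be3 + 208/33
      * t) * hst

end

end Longitudinal

/-! ### Existence of the acoustic and thermal modes -/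

section

variable {s t al2 be2 al3 be3 : ℝ} (s11 s12 : ℝ)

theorem exists_acoustic (hst : 12 * s * t = 1)
    (hB : (108/10549 * al2 - 3888/52745 * be2 + 32/685 * al3 - 1152/3425 * be3 + 992/5775) * s
      + (-59/126588 * al2 + 177/52745 * be2 + 7/685 * al3 - 252/3425 * be3 - 568/5775) * t = 0) :
    ∃ a b d : ℝ, ∀ kx ky w : ℝ, w * w = 4/5 * (kx ^ 2 + ky ^ 2) → ∃ h : Fin 4 → Fin 13 → ℝ,
      h 0 0 = w ∧ h 0 1 = -4/5 * kx ∧ h 0 2 = -4/5 * ky ∧ h 0 3 = -36/5 * w ∧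
      IsMode (dissipation s t s11 s12) (equil al2 be2 al3 be3) kx ky
        ![w, a * (kx ^ 2 + ky ^ 2), b * w * (kx ^ 2 + ky ^ 2), d * (kx ^ 2 + ky ^ 2) ^ 2] h := by
  -- Order 2: mass forces `j1 = -a`, then energy gives `E1` and momentum gives `a`.
  obtain ⟨E1, h3⟩ : ∃ E1 : ℝ, 13/77 * t * al2 - 468/385 * t * be2 + 16328/1925 * t + E1 = 0 :=
    ⟨_, add_neg_cancel _⟩
  obtain ⟨a, h1⟩ : ∃ a : ℝ, -8/25 * s - 8/5 * a + 1/26 * E1 = 0 :=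
    ⟨5/8 * (-8/25 * s + 1/26 * E1), by ring⟩
  -- Order 3: `A` and `B` collect the terms of momentum and energy free of `b, j2, E2`. Adding
  -- `36/5` times mass to energy isolates `E2`; momentum minus mass then gives `b`.
  obtain ⟨A, hA⟩ : ∃ A : ℝ, A = -8/25 * s ^ 2 - 2/5 * s * a - 1/1848 * al2 + 3/770 * be2 - a * a
      + 151/5775 := ⟨_, rfl⟩
  obtain ⟨B, hB'⟩ : ∃ B : ℝ, B = 52/385 * t ^ 2 * al2 - 1872/1925 * t ^ 2 * be2
      + 65312/9625 * t ^ 2 + 52/385 * t * al2 * s11 - 1872/1925 * t * be2 * s11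
      + 13/77 * t * be2 * E1 + 6656/1925 * t * s11 + 364/25 * t * a + 364/25 * t * a
      + 65/77 * t * E1 - 13/385 * al2 + 468/1925 * be2 + a * E1 - 32506/28875 := ⟨_, rfl⟩
  obtain ⟨b, j2, E2, e0, e2, e4⟩ : ∃ b j2 E2 : ℝ, 4/5 * b + j2 + 2/75 = 0 ∧
      A - 4/5 * b + j2 + 1/26 * E2 = 0 ∧ B - 144/25 * b - 36/5 * j2 + 4/5 * E2 = 0 := by
    obtain ⟨E2, hE⟩ : ∃ E2 : ℝ, B + 36/5 * (2/75) + 4/5 * E2 = 0 :=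
      ⟨-5/4 * (B + 36/5 * (2/75)), by ring⟩
    obtain ⟨b, hb⟩ : ∃ b : ℝ, A - 8/5 * b - 2/75 + 1/26 * E2 = 0 :=
      ⟨5/8 * (A - 2/75 + 1/26 * E2), by ring⟩
    exact ⟨b, -4/5 * b - 2/75, E2, by ring, by linear_combination hb, by linear_combination hE⟩
  obtain ⟨C, hC⟩ : ∃ C : Fin 7 → ℝ, C =
    (Longitudinal.acoustic s t s11 s12 al2 be2 al3 be3 a (-a) E1 b j2 E2).residual := ⟨_, rfl⟩
  have hres := Longitudinal.residual_acoustic hst (by linear_combination h1) hB hC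
  -- Order 4: six of the equations determine the unknowns triangularly, and the remaining one
  -- follows from `hres`.
  obtain ⟨d, jA, jB, r3, EA, EB, f0, f1, f2, f3, f4, f5, f6⟩ : ∃ d jA jB r3 EA EB : ℝ,
      C 0 + (jA + d) = 0 ∧ C 1 + (2 * jB + r3 + 2 * d) = 0 ∧
      C 2 + (-36/5 * jA + EA - 36/5 * d) = 0 ∧ C 3 + (-72/5 * jB + EB - 72/5 * d) = 0 ∧
      C 4 + (1/26 * EA + 4/5 * jA - 4/5 * d) = 0 ∧
      C 5 + (14/13 * r3 + 1/26 * EB + 4/5 * (jA + jB) - 8/5 * d) = 0 ∧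
      C 6 + (1/26 * EA + 4/5 * jB - 4/5 * d) = 0 := by
    obtain ⟨EA, hEA⟩ : ∃ EA : ℝ, EA = -36/5 * C 0 - C 2 := ⟨_, rfl⟩
    obtain ⟨d, hd⟩ : ∃ d : ℝ, d = 5/8 * (1/26 * EA - 4/5 * C 0 + C 4) := ⟨_, rfl⟩
    obtain ⟨jB, hjB⟩ : ∃ jB : ℝ, jB = d - 5/4 * (1/26 * EA + C 6) := ⟨_, rfl⟩
    refine ⟨d, -d - C 0, jB, -2 * jB - 2 * d - C 1, EA, 72/5 * (jB + d) - C 3, ?_, ?_, ?_, ?_, ?_,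
      ?_, ?_⟩ <;> linarith
  refine ⟨a, b, d, fun kx ky w hw => ?_⟩
  let m : Longitudinal := ⟨s, t, s11, s12, al2, be2, al3, be3, 1, 4/5, a, b, 4/5 * b, d,
    1, -4/5, -36/5, -a, E1, j2, E2, r3, jA, jB, EA, EB⟩
  -- The coefficients up to `y3` involve neither `d` nor the third-order moments, so the lemmas on
  -- `acoustic`, where these are zero, apply to `m` by definitional equality.
  have h1' : ∀ i : Fin 3, m.y1 (i.castLE (by norm_num)) = 0 :=
    Longitudinal.y1_acoustic (s := s) (t := t) (s11 := s11) (s12 := s12) (a := a) (j1 := -a) (E1 := E1) (b := b)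
      (j2 := j2) (E2 := E2)
  have h2' : ∀ i : Fin 4, m.y2 (i.castLE (by norm_num)) = 0 :=
    Longitudinal.y2_acoustic (s := s) (t := t) (s11 := s11) (s12 := s12) (a := a) (j1 := -a) (E1 := E1) (b := b)
      (j2 := j2) (E2 := E2) (by ring) (by linear_combination h1) (by linear_combination h3)
  have h3' : ∀ i : Fin 6, m.y3 (i.castLE (by norm_num)) = 0 :=
    Longitudinal.y3_acoustic (s := s) (t := t) (s11 := s11) (s12 := s12) (a := a) (j1 := -a) (E1 := E1) (b := b)
      (j2 := j2) (E2 := E2) hst (by linear_combination e0) (by linear_combination e2 - hA)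
      (by linear_combination e4 - hB')
  have h4' : m.y4 = 0 := by
    have hm : m.residual = C := hC.symm
    rw [Longitudinal.y4_eq, hm]
    ext i
    fin_cases i <;> simp [m]
    · linear_combination f0
    · linear_combination f1
    · linear_combination f2
    · linear_combination f3
    · linear_combination f4
    · linear_combination f5
    · linear_combination f6
  refine ⟨m.expansion kx ky w, ?_, ?_, ?_, ?_,
    Longitudinal.isMode (m := m) (v := w) (e := w) ?_ ?_ ?_ h1' h2' h3' h4'⟩
  · simp [Longitudinal.expansion, profile0, Longitudinal.x0, m]
  · simp [Longitudinal.expansion, profile0, Longitudinal.x0, m, mul_comm]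
  · simp [Longitudinal.expansion, profile0, Longitudinal.x0, m, mul_comm]
  · simp [Longitudinal.expansion, profile0, Longitudinal.x0, m, mul_comm]
  · simp [m]
  · simpa [m] using hw
  · simp only [m]
    linear_combination b * hw

theorem exists_thermal (hst : 12 * s * t = 1)
    (hA : 1313/9042 * al2 - 18382/4521 * be2 + 234/685 * al3 - 6552/685 * be3 - 2678/165 = 0) :
    ∃ a d : ℝ, ∀ kx ky : ℝ, ∃ h : Fin 4 → Fin 13 → ℝ,
      h 0 0 = 1 ∧ h 0 1 = 0 ∧ h 0 2 = 0 ∧ h 0 3 = -28 ∧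
      IsMode (dissipation s t s11 s12) (equil al2 be2 al3 be3) kx ky
        ![0, a * (kx ^ 2 + ky ^ 2), 0, d * (kx ^ 2 + ky ^ 2) ^ 2] h := by
  obtain ⟨a, h3⟩ : ∃ a : ℝ, 13/77 * t * al2 - 52/11 * t * be2 - 260/11 * t - 104/5 * a = 0 :=
    ⟨5/104 * (13/77 * t * al2 - 52/11 * t * be2 - 260/11 * t), by ring⟩
  obtain ⟨E2, h2⟩ : ∃ E2 : ℝ, -2/5 * s * a - 1/1848 * al2 + 1/66 * be2 - a ^ 2 + 1/26 * E2
      + 5/66 = 0 :=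
    ⟨-26 * (-2/5 * s * a - 1/1848 * al2 + 1/66 * be2 - a ^ 2 + 5/66), by ring⟩
  obtain ⟨C, hC⟩ : ∃ C : Fin 7 → ℝ, C =
    (Longitudinal.thermal s t s11 s12 al2 be2 al3 be3 a E2).residual := ⟨_, rfl⟩
  obtain ⟨hres, c4, c5, c6⟩ := Longitudinal.residual_thermal hst hA hC
  obtain ⟨d, hd⟩ : ∃ d : ℝ, d = 5/104 * (C 2 + 36/5 * C 0) := ⟨_, rfl⟩
  refine ⟨a, d, fun kx ky => ?_⟩
  -- Mass determines the two momentum coefficients at order 3. The momentum residuals vanish, so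
  -- density and energy can be left at zero there.
  let m : Longitudinal := ⟨s, t, s11, s12, al2, be2, al3, be3, 0, 0, a, 0, 0, d,
    1, 0, -28, -a, 0, 0, E2, 0, -d - C 0, -d - 1/2 * C 1, 0, 0⟩
  have h1' : ∀ i : Fin 3, m.y1 (i.castLE (by norm_num)) = 0 :=
    Longitudinal.y1_thermal (s := s) (t := t) (s11 := s11) (s12 := s12) (a := a) (E2 := E2)
  have h2' : ∀ i : Fin 4, m.y2 (i.castLE (by norm_num)) = 0 :=
    Longitudinal.y2_thermal (s := s) (t := t) (s11 := s11) (s12 := s12) (a := a) (E2 := E2) (by linear_combination h3)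
  have h3' : ∀ i : Fin 6, m.y3 (i.castLE (by norm_num)) = 0 :=
    Longitudinal.y3_thermal (s := s) (t := t) (s11 := s11) (s12 := s12) (a := a) (E2 := E2) hst (by linear_combination h2)
  have h4' : m.y4 = 0 := by
    have hm : m.residual = C := hC.symm
    rw [Longitudinal.y4_eq, hm]
    ext i
    fin_cases i <;> simp [m, c4, c5, c6] <;> linarith
  refine ⟨m.expansion kx ky 1, ?_, ?_, ?_, ?_, ?_⟩
  · simp [Longitudinal.expansion, profile0, Longitudinal.x0, m]
  · simp [Longitudinal.expansion, profile0, Longitudinal.x0, m]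
  · simp [Longitudinal.expansion, profile0, Longitudinal.x0, m]
  · simp [Longitudinal.expansion, profile0, Longitudinal.x0, m]
  · have := Longitudinal.isMode (m := m) (kx := kx) (ky := ky) (v := 1) (e := 0)
      (by simp [m]) (by simp [m]) (by simp [m]) h1' h2' h3' h4'
    simpa [Longitudinal.eigen, m] using this

end

/-! ### Congruences of matrices of power series -/

section EqUpTo

variable {l m n : Type*} {N : ℕ}

theorem eqUpTo_iff {A B : Matrix m n ℂ⟦X⟧} :
    EqUpTo N A B ↔ ∃ D : Matrix m n ℂ⟦X⟧, A = B + (X ^ N : ℂ⟦X⟧) • D := by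
  constructor
  · intro h
    choose D hD using h
    exact ⟨Matrix.of D, by ext1 i j; simpa using eq_add_of_sub_eq' (hD i j)⟩
  · rintro ⟨D, rfl⟩ i j
    simp

theorem EqUpTo.refl (A : Matrix m n ℂ⟦X⟧) : EqUpTo N A A := fun i j => by simp

theorem EqUpTo.symm {A B : Matrix m n ℂ⟦X⟧} (h : EqUpTo N A B) : EqUpTo N B A := fun i j => by
  rw [← neg_sub, dvd_neg]
  exact h i j

theorem EqUpTo.trans {A B D : Matrix m n ℂ⟦X⟧} (h : EqUpTo N A B) (h' : EqUpTo N B D) :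
    EqUpTo N A D := fun i j => by
  rw [← sub_add_sub_cancel _ (B i j)]
  exact dvd_add (h i j) (h' i j)

theorem EqUpTo.mono {M : ℕ} (hMN : M ≤ N) {A B : Matrix m n ℂ⟦X⟧} (h : EqUpTo N A B) :
    EqUpTo M A B := fun i j => (pow_dvd_pow _ hMN).trans (h i j)

theorem EqUpTo.add {A B A' B' : Matrix m n ℂ⟦X⟧} (h : EqUpTo N A B) (h' : EqUpTo N A' B') :
    EqUpTo N (A + A') (B + B') := fun i j => by
  simp only [Matrix.add_apply, add_sub_add_comm]
  exact dvd_add (h i j) (h' i j)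

theorem EqUpTo.sub {A B A' B' : Matrix m n ℂ⟦X⟧} (h : EqUpTo N A B) (h' : EqUpTo N A' B') :
    EqUpTo N (A - A') (B - B') := fun i j => by
  simp only [Matrix.sub_apply, sub_sub_sub_comm]
  exact dvd_sub (h i j) (h' i j)

theorem eqUpTo_sub_zero {A B : Matrix m n ℂ⟦X⟧} : EqUpTo N (A - B) 0 ↔ EqUpTo N A B := by
  simp [EqUpTo]

theorem EqUpTo.mul_left [Fintype m] {A B : Matrix m n ℂ⟦X⟧} (D : Matrix l m ℂ⟦X⟧)
    (h : EqUpTo N A B) : EqUpTo N (D * A) (D * B) := by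
  obtain ⟨E, rfl⟩ := eqUpTo_iff.1 h
  exact eqUpTo_iff.2 ⟨D * E, by rw [Matrix.mul_add, Matrix.mul_smul]⟩

theorem EqUpTo.mul_right [Fintype n] {A B : Matrix m n ℂ⟦X⟧} (h : EqUpTo N A B)
    (D : Matrix n l ℂ⟦X⟧) : EqUpTo N (A * D) (B * D) := by
  obtain ⟨E, rfl⟩ := eqUpTo_iff.1 h
  exact eqUpTo_iff.2 ⟨E * D, by rw [Matrix.add_mul, Matrix.smul_mul]⟩

/-- A product of a matrix that vanishes up to `O(Δt ^ N)` and one that vanishes at `Δt = 0`. -/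
theorem EqUpTo.mul_zero_succ [Fintype m] {A : Matrix m n ℂ⟦X⟧} {D : Matrix l m ℂ⟦X⟧}
    (h : EqUpTo N A 0) (h' : EqUpTo 1 D 0) : EqUpTo (N + 1) (D * A) 0 := by
  obtain ⟨E, rfl⟩ := eqUpTo_iff.1 h
  obtain ⟨F, rfl⟩ := eqUpTo_iff.1 h'
  refine eqUpTo_iff.2 ⟨F * E, ?_⟩
  rw [zero_add, zero_add, zero_add, Matrix.mul_smul, Matrix.smul_mul, smul_smul, ← pow_add]

theorem EqUpTo.zero_mul_succ [Fintype m] {A : Matrix m n ℂ⟦X⟧} {D : Matrix l m ℂ⟦X⟧}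
    (h : EqUpTo 1 A 0) (h' : EqUpTo N D 0) : EqUpTo (N + 1) (D * A) 0 := by
  obtain ⟨E, rfl⟩ := eqUpTo_iff.1 h
  obtain ⟨F, rfl⟩ := eqUpTo_iff.1 h'
  refine eqUpTo_iff.2 ⟨F * E, ?_⟩
  rw [zero_add, zero_add, zero_add, Matrix.mul_smul, Matrix.smul_mul, smul_smul, ← pow_add,
    add_comm 1]

end EqUpTo

/-! ### The truncated exponential of an operator -/

section evolution

/-- The truncated exponential series. -/
def expTrunc (a : ℂ⟦X⟧) : ℂ⟦X⟧ := ∑ m ∈ Finset.range 5, PowerSeries.C ((m.factorial : ℂ)⁻¹) * a ^ m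

theorem evolution_conj_mul {R : Matrix (Fin 4) (Fin 4) ℂ⟦X⟧} (hR : IsUnit R.det)
    (ev : Fin 4 → ℂ⟦X⟧) :
    evolution (R * Matrix.diagonal ev * R⁻¹) * R
      = R * Matrix.diagonal fun j => expTrunc (-(X * ev j)) := by
  have hRR : R⁻¹ * R = 1 := Matrix.nonsing_inv_mul R hR
  have hpow (m : ℕ) : ((-X : ℂ⟦X⟧) • (R * Matrix.diagonal ev * R⁻¹)) ^ m * R
      = R * Matrix.diagonal fun j => (-(X * ev j)) ^ m := by
    induction m with
    | zero => simp
    | succ m ih =>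
      have h1 : ((-X : ℂ⟦X⟧) • (R * Matrix.diagonal ev * R⁻¹)) * R
          = R * Matrix.diagonal fun j => -(X * ev j) := by
        rw [Matrix.smul_mul, Matrix.mul_assoc _ _ R, hRR, Matrix.mul_one, ← Matrix.mul_smul]
        congr 1
        ext i j
        by_cases h : i = j <;> simp [h]
      rw [pow_succ, Matrix.mul_assoc, h1, ← Matrix.mul_assoc, ih, Matrix.mul_assoc,
        Matrix.diagonal_mul_diagonal]
      simp only [pow_succ]
  simp only [evolution, Matrix.sum_mul, Matrix.smul_mul, hpow]
  simp only [← Matrix.mul_smul]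
  rw [← Matrix.mul_sum]
  congr 1
  ext i j
  by_cases h : i = j
  · subst h; simp [Matrix.sum_apply, expTrunc]
  · simp [Matrix.sum_apply, h]

theorem evolution_eqUpTo_one (L : Matrix (Fin 4) (Fin 4) ℂ⟦X⟧) : EqUpTo 1 (evolution L) 1 := by
  refine eqUpTo_iff.2 ⟨- ∑ m ∈ Finset.range 4,
    PowerSeries.C (((m + 1).factorial : ℂ)⁻¹) • (((-X : ℂ⟦X⟧) • L) ^ m * L), ?_⟩
  rw [evolution, Finset.sum_range_succ', add_comm]
  congr 1
  · simp
  · rw [smul_neg, Finset.smul_sum, ← Finset.sum_neg_distrib]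
    refine Finset.sum_congr rfl fun m _ => ?_
    rw [pow_succ, Matrix.mul_smul, smul_comm (X ^ 1 : ℂ⟦X⟧), pow_one, neg_smul, smul_neg]

/-- The evolution determines the operator. -/
theorem eqUpTo_of_evolution {L L' : Matrix (Fin 4) (Fin 4) ℂ⟦X⟧}
    (h : EqUpTo 5 (evolution L) (evolution L')) : EqUpTo 4 L L' := by
  set A := (-X : ℂ⟦X⟧) • L with hA
  set A' := (-X : ℂ⟦X⟧) • L' with hA'
  have hA1 : EqUpTo 1 A 0 := eqUpTo_iff.2 ⟨-L, by simp [hA]⟩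
  have hA1' : EqUpTo 1 A' 0 := eqUpTo_iff.2 ⟨-L', by simp [hA']⟩
  have hdiff (N : ℕ) (hN : EqUpTo N (A - A') 0) (m : ℕ) :
      EqUpTo (N + 1) (A ^ (m + 2)) (A' ^ (m + 2)) := by
    have h1 (m : ℕ) : EqUpTo N (A ^ (m + 1)) (A' ^ (m + 1)) := by
      induction m with
      | zero => simpa using eqUpTo_sub_zero.1 hN
      | succ m ih =>
        rw [pow_succ A, pow_succ A']
        exact (ih.mul_right _).trans ((eqUpTo_sub_zero.1 hN).mul_left _)
    have h2 : A ^ (m + 2) - A' ^ (m + 2)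
        = (A ^ (m + 1) - A' ^ (m + 1)) * A + A' ^ (m + 1) * (A - A') := by
      rw [pow_succ A (m + 1), pow_succ A' (m + 1)]
      noncomm_ring
    have h3 : EqUpTo 1 (A' ^ (m + 1)) 0 := by
      rw [pow_succ]
      simpa using hA1'.mul_left (A' ^ m)
    refine eqUpTo_sub_zero.1 ?_
    rw [h2]
    simpa using (hA1.zero_mul_succ (eqUpTo_sub_zero.2 (h1 m))).add (hN.mul_zero_succ h3)
  have hexp (L : Matrix (Fin 4) (Fin 4) ℂ⟦X⟧) : evolution L = 1 + (-X : ℂ⟦X⟧) • L +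
      ∑ m ∈ Finset.range 3, PowerSeries.C (((m + 2).factorial : ℂ)⁻¹)
        • ((-X : ℂ⟦X⟧) • L) ^ (m + 2) := by
    rw [evolution, Finset.sum_range_succ', Finset.sum_range_succ']
    simp
    abel
  -- Bootstrap: `A` and `A'` vanish at `Δt = 0`, so if they agree up to order `N`, their powers of
  -- exponent at least 2 agree up to order `N + 1`, and then so do the linear terms.
  have key : ∀ N ≤ 5, EqUpTo N (A - A') 0 := by
    intro N
    induction N with
    | zero => exact fun _ i j => by simp
    | succ N ih =>
      intro hN
      have ih := hdiff N (ih (by omega))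
      have hs : EqUpTo (N + 1)
          (∑ m ∈ Finset.range 3, PowerSeries.C (((m + 2).factorial : ℂ)⁻¹) • A ^ (m + 2))
          (∑ m ∈ Finset.range 3, PowerSeries.C (((m + 2).factorial : ℂ)⁻¹) • A' ^ (m + 2)) := by
        intro i j
        simp only [Matrix.sum_apply, Matrix.smul_apply, ← Finset.sum_sub_distrib, ← smul_sub]
        exact Finset.dvd_sum fun m _ => (ih m i j).mul_left _
      have h' := (h.mono hN).sub hs
      rw [hexp, hexp, ← hA, ← hA', add_sub_cancel_right, add_sub_cancel_right] at h'
      refine eqUpTo_sub_zero.2 fun i j => ?_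
      simpa using h' i j
  intro i j
  -- Dividing `-Δt L` by `Δt` costs one order, from 5 to 4.
  have h5 : (X : ℂ⟦X⟧) * X ^ 4 ∣ -(X * (L i j - L' i j)) := by
    have h := key 5 le_rfl i j
    simp only [hA, hA', Matrix.sub_apply, Matrix.smul_apply, Matrix.zero_apply, sub_zero,
      smul_eq_mul] at h
    convert h using 1 <;> ring
  rw [dvd_neg] at h5
  exact (mul_dvd_mul_iff_left X_ne_zero).1 h5

end evolution

/-! ### Existence and uniqueness of the equivalent operator -/

section const

variable {l m n : Type*}

theorem const_mul [Fintype m] (A : Matrix l m ℝ) (B : Matrix m n ℝ) :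
    const (A * B) = const A * const B := by
  ext1 i j
  simp [const, Matrix.mul_apply]

theorem const_one [DecidableEq m] : const (1 : Matrix m m ℝ) = 1 := by
  ext1 i j
  by_cases h : i = j
  · subst h; simp [const]
  · simp [const, h]

theorem const_add (A B : Matrix m n ℝ) : const (A + B) = const A + const B := by
  ext1 i j
  simp [const]

theorem const_sub (A B : Matrix m n ℝ) : const (A - B) = const A - const B := by
  ext1 i j
  simp [const]

end const

variable {P : Params}

theorem conserved_mul_equilibrium (P : Params) : conserved * equilibrium P = 1 := by
  ext i j
  fin_cases i <;> fin_cases j <;>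
    simp [conserved, equilibrium, Matrix.mul_apply, Fin.sum_univ_succ]

theorem conserved_mul_diagonal_rates (P : Params) :
    conserved * Matrix.diagonal (rates P) = 0 := by
  ext i j
  rw [Matrix.mul_diagonal]
  fin_cases i <;> fin_cases j <;> simp [conserved, rates]

theorem conserved_mul_collision (P : Params) : conserved * collision P = conserved := by
  rw [collision, Matrix.mul_add, Matrix.mul_one, ← Matrix.mul_assoc,
    conserved_mul_diagonal_rates, Matrix.zero_mul, add_zero]

theorem collision_mul_equilibrium (P : Params) : collision P * equilibrium P = equilibrium P := by
  rw [collision, Matrix.add_mul, Matrix.mul_assoc, Matrix.sub_mul, Matrix.mul_assoc,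
    conserved_mul_equilibrium]
  simp

theorem rescale_exp_eq_one_add (a : ℂ) :
    ∃ b : ℂ⟦X⟧, PowerSeries.rescale a (PowerSeries.exp ℂ) = 1 + X * b := by
  have h : (X : ℂ⟦X⟧) ∣ PowerSeries.rescale a (PowerSeries.exp ℂ) - 1 := by
    rw [PowerSeries.X_dvd_iff, map_sub, ← PowerSeries.coeff_zero_eq_constantCoeff_apply,
      PowerSeries.coeff_rescale]
    simp
  obtain ⟨b, hb⟩ := h
  exact ⟨b, by rw [← hb]; ring⟩

theorem timeStep_eqUpTo_one (hlam : P.lam ≠ 0) (k : ℝ × ℝ) :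
    EqUpTo 1 (timeStep P k) (const (collision P)) := by
  have h1 : EqUpTo 1 (Matrix.diagonal (fun j => PowerSeries.rescale
      (Complex.I * ((k.1 * (vel P.lam j).1 + k.2 * (vel P.lam j).2 : ℝ) : ℂ))
      (PowerSeries.exp ℂ))) (1 : Matrix (Fin 13) (Fin 13) ℂ⟦X⟧) := by
    intro i j
    by_cases h : i = j
    · subst h
      obtain ⟨b, hb⟩ := rescale_exp_eq_one_add
        (Complex.I * ((k.1 * (vel P.lam i).1 + k.2 * (vel P.lam i).2 : ℝ) : ℂ))
      rw [Matrix.diagonal_apply_eq, Matrix.one_apply_eq, hb]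
      simp
    · simp [h]
  have h2 := ((h1.mul_left (const (momentMatrix P.lam))).mul_right
    (const (momentMatrix P.lam)⁻¹)).mul_right (const (collision P))
  rwa [Matrix.mul_one, ← const_mul, Matrix.mul_nonsing_inv _
    ((Matrix.isUnit_iff_isUnit_det _).1 (isUnit_momentMatrix hlam)), const_one, Matrix.one_mul]
    at h2

theorem timeStep_zero (hlam : P.lam ≠ 0) : timeStep P (0, 0) = const (collision P) := by
  have h1 : Matrix.diagonal (fun j => PowerSeries.rescale
      (Complex.I * (((0 : ℝ) * (vel P.lam j).1 + (0 : ℝ) * (vel P.lam j).2 : ℝ) : ℂ))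
      (PowerSeries.exp ℂ)) = 1 := by
    simp
  rw [timeStep, h1, Matrix.mul_one, ← const_mul, Matrix.mul_nonsing_inv _
    ((Matrix.isUnit_iff_isUnit_det _).1 (isUnit_momentMatrix hlam)), const_one, Matrix.one_mul]

/-- Four independent expansions of eigenmodes give an equivalent operator. -/
theorem isEquivalentOperator_of_modes {k : ℝ × ℝ} {Φ : Matrix (Fin 13) (Fin 4) ℂ⟦X⟧}
    {ev : Fin 4 → ℂ⟦X⟧} (hR : IsUnit (const conserved * Φ).det)
    (h : EqUpTo 5 (timeStep P k * Φ) (Φ * Matrix.diagonal fun j => expTrunc (-(X * ev j)))) :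
    IsEquivalentOperator P k
      (const conserved * Φ * Matrix.diagonal ev * (const conserved * Φ)⁻¹) := by
  set R := const conserved * Φ with hRdef
  refine ⟨Φ * R⁻¹, ?_, ?_⟩
  · rw [← Matrix.mul_assoc, Matrix.mul_nonsing_inv _ hR]
  · have h1 := (h.mul_right R⁻¹).symm
    have h2 : evolution (R * Matrix.diagonal ev * R⁻¹)
        = (R * Matrix.diagonal fun j => expTrunc (-(X * ev j))) * R⁻¹ := by
      rw [← evolution_conj_mul hR, Matrix.mul_assoc (evolution _), Matrix.mul_nonsing_inv _ hR,
        Matrix.mul_one]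
    rw [h2, ← Matrix.mul_assoc (timeStep P k)]
    convert h1 using 1
    rw [Matrix.mul_assoc R, ← Matrix.mul_assoc (Φ * R⁻¹), Matrix.mul_assoc Φ,
      Matrix.nonsing_inv_mul _ hR, Matrix.mul_one, Matrix.mul_assoc]

/-- A matrix of moments that is invariant under the collision vanishes if its conserved
moments do. -/
theorem eqUpTo_zero_of_collision (hr : ∀ i : Fin 13, 4 ≤ (i : ℕ) → rates P i ≠ 0) {N : ℕ}
    {D : Matrix (Fin 13) (Fin 4) ℂ⟦X⟧} (h0 : const conserved * D = 0)
    (hD : EqUpTo N (const (collision P) * D) D) : EqUpTo N D 0 := by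
  have h1 : const (collision P) * D
      = D - const (Matrix.diagonal (rates P)) * D := by
    have : const (collision P) = 1 + const (Matrix.diagonal (rates P))
        * (const (equilibrium P) * const conserved - 1) := by
      rw [← const_mul, ← const_one, ← const_sub, ← const_mul, ← const_add, collision]
    rw [this, Matrix.add_mul, Matrix.mul_assoc, Matrix.sub_mul, Matrix.mul_assoc, h0]
    simp [sub_eq_add_neg]
  have hconst : const (Matrix.diagonal (rates P))
      = Matrix.diagonal fun i => PowerSeries.C ((rates P i : ℝ) : ℂ) := by
    ext1 i j
    by_cases h : i = j <;> simp [const, h]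
  intro i j
  by_cases hi : 4 ≤ (i : ℕ)
  · have h2 := hD i j
    rw [h1, hconst, Matrix.sub_apply, Matrix.diagonal_mul, sub_sub_cancel_left, dvd_neg] at h2
    have hu : IsUnit (PowerSeries.C ((rates P i : ℝ) : ℂ)) :=
      (IsUnit.mk0 _ (by exact_mod_cast hr i hi)).map _
    simpa using hu.dvd_mul_left.1 h2
  · have h2 := congrFun (congrFun h0 ⟨i, by omega⟩) j
    rw [Matrix.mul_apply, Finset.sum_eq_single i] at h2
    · simp [const, conserved] at h2
      simp [h2]
    · intro b _ hb
      simp [const, conserved, Fin.val_ne_of_ne hb]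
    · simp

/-- The equivalent operator is determined up to `O(Δt ^ 4)`. -/
theorem IsEquivalentOperator.unique (hlam : P.lam ≠ 0)
    (hr : ∀ i : Fin 13, 4 ≤ (i : ℕ) → rates P i ≠ 0) {k : ℝ × ℝ}
    {L L' : Matrix (Fin 4) (Fin 4) ℂ⟦X⟧} (h : IsEquivalentOperator P k L)
    (h' : IsEquivalentOperator P k L') : EqUpTo 4 L L' := by
  obtain ⟨Ψ, hW, hT⟩ := h
  obtain ⟨Ψ', hW', hT'⟩ := h'
  set T := timeStep P k with hTdef
  set Cm := const (collision P) with hC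
  have hcons : const conserved * (Ψ - Ψ') = 0 := by rw [Matrix.mul_sub, hW, hW', sub_self]
  have hcC : const conserved * Cm = const conserved := by
    rw [hC, ← const_mul, conserved_mul_collision]
  have hTC : EqUpTo 1 (T - Cm) 0 := eqUpTo_sub_zero.2 (timeStep_eqUpTo_one hlam k)
  have hev (Ψ : Matrix (Fin 13) (Fin 4) ℂ⟦X⟧) (L : Matrix (Fin 4) (Fin 4) ℂ⟦X⟧)
      (hW : const conserved * Ψ = 1) (hT : EqUpTo 5 (Ψ * evolution L) (T * Ψ)) :
      EqUpTo 5 (evolution L) (const conserved * (T * Ψ)) := by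
    have := hT.mul_left (const conserved)
    rwa [← Matrix.mul_assoc, hW, Matrix.one_mul] at this
  have step (N : ℕ) (hN : EqUpTo N (Ψ - Ψ') 0) :
      EqUpTo (N + 1) (T * (Ψ - Ψ')) (Cm * (Ψ - Ψ')) := by
    refine eqUpTo_sub_zero.1 ?_
    rw [← Matrix.sub_mul]
    exact hN.mul_zero_succ hTC
  have stepL (N : ℕ) (hN5 : N + 1 ≤ 5) (hN : EqUpTo N (Ψ - Ψ') 0) :
      EqUpTo (N + 1) (evolution L) (evolution L') := by
    have h1 := ((hev Ψ L hW hT).mono hN5).sub ((hev Ψ' L' hW' hT').mono hN5)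
    have h2 := (step N hN).mul_left (const conserved)
    rw [← Matrix.mul_assoc _ Cm, hcC, hcons, Matrix.mul_sub T, Matrix.mul_sub (const conserved)]
      at h2
    exact eqUpTo_sub_zero.1 (h1.trans h2)
  -- At `Δt = 0` a time step is the collision, so on a difference of order `N` it acts as the
  -- collision up to order `N + 1`. The collision preserves the conserved moments, which are zero
  -- here, so the evolutions agree up to order `N + 1`. The difference is then fixed by the
  -- collision at that order, hence vanishes because the rates are nonzero.
  have key : ∀ N ≤ 5, EqUpTo N (Ψ - Ψ') 0 := by
    intro N
    induction N with
    | zero => exact fun _ i j => by simp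
    | succ N ih =>
      intro hN
      have ih := ih (by omega)
      refine eqUpTo_zero_of_collision hr hcons ?_
      have h1 : EqUpTo (N + 1) (Ψ * evolution L - Ψ' * evolution L') (Ψ - Ψ') := by
        have h2 : Ψ * evolution L - Ψ' * evolution L' - (Ψ - Ψ')
            = (Ψ - Ψ') * (evolution L - 1) + Ψ' * (evolution L - evolution L') := by
          simp only [Matrix.mul_sub, Matrix.sub_mul, Matrix.mul_one]
          abel
        refine eqUpTo_sub_zero.1 ?_
        rw [h2]
        have h3 := (eqUpTo_sub_zero.2 (evolution_eqUpTo_one L)).zero_mul_succ ih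
        have h4 := (eqUpTo_sub_zero.2 (stepL N hN ih)).mul_left Ψ'
        rw [Matrix.mul_zero] at h4
        simpa using h3.add h4
      have h5 : EqUpTo (N + 1) (Ψ * evolution L - Ψ' * evolution L') (T * (Ψ - Ψ')) := by
        rw [Matrix.mul_sub]
        exact (hT.mono hN).sub (hT'.mono hN)
      exact ((step N ih).symm.trans h5.symm).trans h1
  exact eqUpTo_of_evolution (stepL 4 le_rfl (key 4 (by norm_num)))

/-- Four independent expansions of eigenmodes give the eigenvalues of every equivalent operator. -/
theorem hasEigenvaluesUpTo4_of_modes (hlam : P.lam ≠ 0)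
    (hr : ∀ i : Fin 13, 4 ≤ (i : ℕ) → rates P i ≠ 0) {k : ℝ × ℝ}
    {Φ : Matrix (Fin 13) (Fin 4) ℂ⟦X⟧} {ev : Fin 4 → ℂ⟦X⟧}
    (hR : IsUnit (const conserved * Φ).det)
    (h : EqUpTo 5 (timeStep P k * Φ) (Φ * Matrix.diagonal fun j => expTrunc (-(X * ev j))))
    {L : Matrix (Fin 4) (Fin 4) ℂ⟦X⟧} (hL : IsEquivalentOperator P k L) :
    HasEigenvaluesUpTo4 L ev := by
  refine ⟨_, hR, ?_⟩
  have := (hL.unique hlam hr (isEquivalentOperator_of_modes hR h)).mul_right (const conserved * Φ)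
  rwa [Matrix.mul_assoc _ _ (const conserved * Φ), Matrix.nonsing_inv_mul _ hR,
    Matrix.mul_one] at this

/-! ### The transport relation in power series -/

section expTrunc

theorem expTrunc_eq (a : ℂ⟦X⟧) : expTrunc a
    = 1 + a + (1/2 : ℂ) • a ^ 2 + (1/6 : ℂ) • a ^ 3 + (1/24 : ℂ) • a ^ 4 := by
  simp [expTrunc, Finset.sum_range_succ, PowerSeries.smul_eq_C_mul, Nat.factorial]

theorem expTrunc_neg_mul_expTrunc_add (y a x : ℂ⟦X⟧) :
    y ^ 5 ∣ expTrunc (-(y * a)) * expTrunc (y * a + y * x) - expTrunc (y * x) := by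
  refine ⟨(-1/24 : ℂ) • (a * x ^ 4) + (-1/12 : ℂ) • (a ^ 2 * x ^ 3) + (-1/12 : ℂ) • (a ^ 3 * x ^ 2)
    + (-1/24 : ℂ) • (a ^ 4 * x) + (1/48 : ℂ) • (y * a ^ 2 * x ^ 4)
    + (1/18 : ℂ) • (y * a ^ 3 * x ^ 3) + (1/16 : ℂ) • (y * a ^ 4 * x ^ 2)
    + (1/24 : ℂ) • (y * a ^ 5 * x) + (1/72 : ℂ) • (y * a ^ 6)
    + (-1/144 : ℂ) • (y ^ 2 * a ^ 3 * x ^ 4) + (-1/48 : ℂ) • (y ^ 2 * a ^ 4 * x ^ 3)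
    + (-1/48 : ℂ) • (y ^ 2 * a ^ 5 * x ^ 2) + (-1/144 : ℂ) • (y ^ 2 * a ^ 6 * x)
    + (1/576 : ℂ) • (y ^ 3 * a ^ 4 * x ^ 4) + (1/144 : ℂ) • (y ^ 3 * a ^ 5 * x ^ 3)
    + (1/96 : ℂ) • (y ^ 3 * a ^ 6 * x ^ 2) + (1/144 : ℂ) • (y ^ 3 * a ^ 7 * x)
    + (1/576 : ℂ) • (y ^ 3 * a ^ 8), ?_⟩
  simp only [expTrunc_eq]
  algebra

/-- `exp w (1 - τ / 2) = 1 + τ / 2` up to the order 4, for `τ = w - w³ / 12`. -/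
theorem expTrunc_mul_one_sub (y w : ℂ⟦X⟧) :
    y ^ 5 ∣ expTrunc (y * w) * (1 - (1/2 : ℂ) • (y * w - (1/12 : ℂ) • (y * w) ^ 3))
      - (1 + (1/2 : ℂ) • (y * w - (1/12 : ℂ) • (y * w) ^ 3)) := by
  refine ⟨(1/144 : ℂ) • (y * w ^ 6) + (1/576 : ℂ) • (y ^ 2 * w ^ 7), ?_⟩
  simp only [expTrunc_eq]
  algebra

/-- The expansion of `(w - w³ / 12) g`, where `w = v y + e₂ y² + e₃ y³ + e₄ y⁴`. -/
theorem tau_mul_expansion (y v e2 e3 e4 g0 g1 g2 g3 g4 : ℂ⟦X⟧) :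
    y ^ 5 ∣ (y * (v + e2 * y + e3 * y ^ 2 + e4 * y ^ 3)
          - (1/12 : ℂ) • (y * (v + e2 * y + e3 * y ^ 2 + e4 * y ^ 3)) ^ 3)
        * (g0 + g1 * y + g2 * y ^ 2 + g3 * y ^ 3 + g4 * y ^ 4)
      - (v * g0 * y + (v * g1 + e2 * g0) * y ^ 2
        + (v * g2 + e2 * g1 + e3 * g0 - (1/12 : ℂ) • (v ^ 3 * g0)) * y ^ 3
        + (v * g3 + e2 * g2 + e3 * g1 + e4 * g0 - (1/12 : ℂ) • (v ^ 3 * g1)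
          - (1/4 : ℂ) • (e2 * v ^ 2 * g0)) * y ^ 4) := by
  refine ⟨v * g4 + e2 * g3 + e3 * g2 + e4 * g1 + y * (e2 * g4 + e3 * g3 + e4 * g2)
    + y ^ 2 * (e3 * g4 + e4 * g3) + y ^ 3 * e4 * g4
    - (1/12 : ℂ) • ((3 * v ^ 2 * (e3 + e4 * y) + 3 * v * (e2 + y * (e3 + e4 * y)) ^ 2
        + y * (e2 + y * (e3 + e4 * y)) ^ 3)
        * (g0 + g1 * y + g2 * y ^ 2 + g3 * y ^ 3 + g4 * y ^ 4)
      + 3 * v ^ 2 * e2 * g1 + v ^ 3 * (g2 + g3 * y + g4 * y ^ 2)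
      + 3 * v ^ 2 * e2 * y * (g2 + g3 * y + g4 * y ^ 2)), ?_⟩
  algebra

theorem rescale_exp_sub_expTrunc (a : ℂ) :
    (X : ℂ⟦X⟧) ^ 5 ∣ PowerSeries.rescale a (PowerSeries.exp ℂ) - expTrunc (PowerSeries.C a * X) := by
  rw [PowerSeries.X_pow_dvd_iff]
  intro m hm
  have h (n : ℕ) : PowerSeries.coeff m (PowerSeries.C ((n.factorial : ℂ)⁻¹)
      * (PowerSeries.C a * X) ^ n) = if m = n then (n.factorial : ℂ)⁻¹ * a ^ n else 0 := by
    rw [mul_pow, ← map_pow, ← mul_assoc, ← map_mul, PowerSeries.coeff_C_mul, PowerSeries.coeff_X_pow]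
    simp
  rw [map_sub, expTrunc, map_sum]
  simp only [h]
  rw [Finset.sum_ite_eq, if_pos (by simpa using hm), PowerSeries.coeff_rescale,
    PowerSeries.coeff_exp]
  simp [mul_comm]

/-- The populations before and after the collision satisfy the transport equation of an
eigenmode. -/
theorem transport_expansion {y D v e1 e2 e3 e4 g0 g1 g2 g3 g4 t : ℂ⟦X⟧} (v0 : ℂ⟦X⟧)
    (hD : y ^ 5 ∣ D - expTrunc (y * v0)) (hv : v = v0 + e1)
    (ht : t = v * g0 * y + (v * g1 + e2 * g0) * y ^ 2
        + (v * g2 + e2 * g1 + e3 * g0 - (1/12 : ℂ) • (v ^ 3 * g0)) * y ^ 3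
        + (v * g3 + e2 * g2 + e3 * g1 + e4 * g0 - (1/12 : ℂ) • (v ^ 3 * g1)
          - (1/4 : ℂ) • (e2 * v ^ 2 * g0)) * y ^ 4) :
    y ^ 5 ∣ D * (g0 + g1 * y + g2 * y ^ 2 + g3 * y ^ 3 + g4 * y ^ 4 - (1/2 : ℂ) • t)
      - expTrunc (-(y * (e1 + e2 * y + e3 * y ^ 2 + e4 * y ^ 3)))
        * (g0 + g1 * y + g2 * y ^ 2 + g3 * y ^ 3 + g4 * y ^ 4 + (1/2 : ℂ) • t) := by
  set G := g0 + g1 * y + g2 * y ^ 2 + g3 * y ^ 3 + g4 * y ^ 4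
  set ε := e1 + e2 * y + e3 * y ^ 2 + e4 * y ^ 3 with hε
  have hw : v + e2 * y + e3 * y ^ 2 + e4 * y ^ 3 = ε + v0 := by rw [hv, hε]; ring
  have h1 := tau_mul_expansion y v e2 e3 e4 g0 g1 g2 g3 g4
  rw [← ht, hw] at h1
  have h2 := expTrunc_neg_mul_expTrunc_add y ε v0
  have h3 := expTrunc_mul_one_sub y (ε + v0)
  rw [← mul_add] at h2
  set T := y * (ε + v0) - (1/12 : ℂ) • (y * (ε + v0)) ^ 3
  set A := expTrunc (-(y * ε))
  set B := expTrunc (y * (ε + v0))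
  set E := expTrunc (y * v0)
  have h4 : y ^ 5 ∣ (1/2 : ℂ) • T * G - (1/2 : ℂ) • t := by
    rw [smul_mul_assoc, ← smul_sub, PowerSeries.smul_eq_C_mul]
    exact h1.mul_left _
  generalize (1/2 : ℂ) • T = T' at *
  generalize (1/2 : ℂ) • t = t' at *
  -- Telescoping through `D ≈ E`, `A B ≈ E`, `T' G ≈ t'` and `B (1 - T') ≈ 1 + T'`, each valid
  -- modulo `y⁵`.
  have key : D * (G - t') - A * (G + t') = (D - E) * (G - t') - (A * B - E) * (G - t')
        + A * B * (T' * G - t') + A * (T' * G - t') + A * G * (B * (1 - T') - (1 + T')) := by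
    clear_value A B E G
    ring
  rw [key]
  exact dvd_add (dvd_add (dvd_add (dvd_sub (hD.mul_right _) (h2.mul_right _)) (h4.mul_left _))
    (h4.mul_left _)) (h3.mul_left _)

end expTrunc

/-! ### The collision in terms of mean and jump -/

section collision

theorem conserved_mulVec (v : Fin 13 → ℝ) (a : Fin 4) :
    (conserved *ᵥ v) a = v (a.castLE (by norm_num)) := by
  fin_cases a <;> simp [conserved, Matrix.mulVec, dotProduct, Fin.sum_univ_succ]

theorem equilibrium_mulVec {P : Params} (hc0 : P.c0 ^ 2 = 4/5 * P.lam ^ 2) (hxi : P.xi = 0)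
    (h : Fin 13 → ℝ) (i : Fin 13) :
    (equilibrium P *ᵥ (conserved *ᵥ fun i => P.lam ^ momentDegree i * h i)) i
      = P.lam ^ momentDegree i * equil P.alpha2 P.beta2 P.alpha3 P.beta3 h i := by
  have h0 := conserved_mulVec (fun i => P.lam ^ momentDegree i * h i) 0
  have h1 := conserved_mulVec (fun i => P.lam ^ momentDegree i * h i) 1
  have h2 := conserved_mulVec (fun i => P.lam ^ momentDegree i * h i) 2
  have h3 := conserved_mulVec (fun i => P.lam ^ momentDegree i * h i) 3
  change _ = P.lam ^ 0 * h 0 at h0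
  change _ = P.lam ^ 1 * h 1 at h1
  change _ = P.lam ^ 1 * h 2 at h2
  change _ = P.lam ^ 2 * h 3 at h3
  generalize conserved *ᵥ (fun i => P.lam ^ momentDegree i * h i) = w at *
  simp only [Matrix.mulVec, dotProduct, Fin.sum_univ_four, h0, h1, h2, h3]
  fin_cases i <;>
    simp [equilibrium, equil, momentDegree, hc0, hxi] <;> ring

theorem collision_mulVec (P : Params) (v : Fin 13 → ℝ) (i : Fin 13) :
    (collision P *ᵥ v) i
      = v i + rates P i * ((equilibrium P *ᵥ (conserved *ᵥ v)) i - v i) := by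
  rw [collision, Matrix.add_mulVec, Matrix.one_mulVec, ← Matrix.mulVec_mulVec, Matrix.sub_mulVec,
    Matrix.one_mulVec, Matrix.mulVec_mulVec, Pi.add_apply, Matrix.mulVec_diagonal, Pi.sub_apply]

theorem equil_add {al2 be2 al3 be3 : ℝ} {h θ : Fin 13 → ℝ} (c : ℝ)
    (hθ : ∀ i : Fin 4, θ (i.castLE (by norm_num)) = 0) :
    equil al2 be2 al3 be3 (fun i => h i + c * θ i) = equil al2 be2 al3 be3 h := by
  have h0 := hθ 0
  have h1 := hθ 1
  have h2 := hθ 2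
  have h3 := hθ 3
  simp only [Fin.castLE] at h0 h1 h2 h3
  change θ 0 = 0 at h0
  change θ 1 = 0 at h1
  change θ 2 = 0 at h2
  change θ 3 = 0 at h3
  simp [equil, h0, h1, h2, h3]

/-- For `m = h + θ/2` and `m* = h - θ/2`, the rule `m - m* = s (m - m_eq)` is `h = m_eq + (1/s -
1/2) θ`. Since `θ` has no conserved part, the equilibria of `m` and `h` coincide. -/
theorem collision_mulVec_mean {P : Params} (hc0 : P.c0 ^ 2 = 4/5 * P.lam ^ 2) (hxi : P.xi = 0)
    {sig : Fin 13 → ℝ}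
    (hsig : ∀ i : Fin 13, 4 ≤ (i : ℕ) → rates P i ≠ 0 ∧ sig i = sigma (rates P i))
    {h θ : Fin 13 → ℝ} (hh : h = equil P.alpha2 P.beta2 P.alpha3 P.beta3 h + sig * θ)
    (hθ : ∀ i : Fin 4, θ (i.castLE (by norm_num)) = 0) :
    (collision P *ᵥ fun i => P.lam ^ momentDegree i * (h i + 1/2 * θ i))
      = fun i => P.lam ^ momentDegree i * (h i - 1/2 * θ i) := by
  funext i
  rw [collision_mulVec, equilibrium_mulVec hc0 hxi, equil_add _ hθ]
  by_cases hi : 4 ≤ (i : ℕ)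
  · obtain ⟨h0, h1⟩ := hsig i hi
    have h2 := congrFun hh i
    rw [Pi.add_apply, Pi.mul_apply, h1, sigma] at h2
    have h3 : equil P.alpha2 P.beta2 P.alpha3 P.beta3 h i
        = h i - (1 / rates P i - 1 / 2) * θ i := by linarith
    rw [h3]
    field_simp
    ring
  · have h1 : rates P i = 0 := by
      have : (i : ℕ) < 4 := by omega
      obtain ⟨i, hi'⟩ := i
      simp only at this
      interval_cases i <;> rfl
    have h2 : θ i = 0 := hθ ⟨i, by omega⟩
    rw [h1, h2]
    ring

end collision

/-! ### From a mode to an expansion of the populations -/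

section populations

theorem moments_add (f g : Fin 13 → ℝ) : moments (f + g) = moments f + moments g :=
  Matrix.mulVec_add _ _ _

theorem moments_sub (f g : Fin 13 → ℝ) : moments (f - g) = moments f - moments g :=
  Matrix.mulVec_sub _ _ _

theorem moments_smul (c : ℝ) (g : Fin 13 → ℝ) : moments (c • g) = c • moments g :=
  Matrix.mulVec_smul _ _ _

theorem moments_shift (kx ky e : ℝ) (g : Fin 13 → ℝ) :
    moments (fun j => (wave kx ky j + e) * g j) = shift kx ky e (moments g) := by
  rw [shift, ← moments_wave, ← moments_smul, ← moments_add]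
  congr 1
  funext j
  simp
  ring

/-- The coefficients of `(w - w³ / 12) g`, for the populations `g`. -/
def tau (kx ky : ℝ) (e : Fin 4 → ℝ) (g : Fin 5 → Fin 13 → ℝ) : Fin 5 → Fin 13 → ℝ :=
  ![0,
    fun j => (wave kx ky j + e 0) * g 0 j,
    fun j => (wave kx ky j + e 0) * g 1 j + e 1 * g 0 j,
    fun j => (wave kx ky j + e 0) * g 2 j + e 1 * g 1 j + e 2 * g 0 j
      - 1/12 * ((wave kx ky j + e 0) ^ 3 * g 0 j),
    fun j => (wave kx ky j + e 0) * g 3 j + e 1 * g 2 j + e 2 * g 1 j + e 3 * g 0 j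
      - 1/12 * ((wave kx ky j + e 0) ^ 3 * g 1 j)
      - 1/4 * (e 1 * (wave kx ky j + e 0) ^ 2 * g 0 j)]

theorem moments_tau (kx ky : ℝ) (e : Fin 4 → ℝ) {g : Fin 5 → Fin 13 → ℝ}
    {h : Fin 4 → Fin 13 → ℝ} (hg : ∀ n : Fin 4, moments (g n.castSucc) = h n) (n : Fin 5) :
    moments (tau kx ky e g n) = (Fin.cons 0 (theta kx ky e h) : Fin 5 → Fin 13 → ℝ) n := by
  have h0 : moments (g 0) = h 0 := hg 0
  have h1 : moments (g 1) = h 1 := hg 1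
  have h2 : moments (g 2) = h 2 := hg 2
  have h3 : moments (g 3) = h 3 := hg 3
  refine Fin.cases ?_ (fun n => ?_) n
  · exact Matrix.mulVec_zero _
  · rw [Fin.cons_succ]
    fin_cases n
    · change moments (fun j => (wave kx ky j + e 0) * g 0 j) = shift kx ky (e 0) (h 0)
      rw [moments_shift, h0]
    · change _ = shift kx ky (e 0) (h 1) + e 1 • h 0
      rw [← h0, ← h1, ← moments_shift, ← moments_smul, ← moments_add]
      rfl
    · change _ = shift kx ky (e 0) (h 2) + e 1 • h 1 + e 2 • h 0
        - (1/12 : ℝ) • shift kx ky (e 0) (shift kx ky (e 0) (shift kx ky (e 0) (h 0)))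
      simp only [← h0, ← h1, ← h2, ← moments_shift, ← moments_smul, ← moments_add, ← moments_sub]
      congr 1
      funext j
      simp [tau]
      ring
    · change _ = shift kx ky (e 0) (h 3) + e 1 • h 2 + e 2 • h 1 + e 3 • h 0
        - (1/12 : ℝ) • shift kx ky (e 0) (shift kx ky (e 0) (shift kx ky (e 0) (h 1)))
        - (e 1 / 4) • shift kx ky (e 0) (shift kx ky (e 0) (h 0))
      simp only [← h0, ← h1, ← h2, ← h3, ← moments_shift, ← moments_smul, ← moments_add,
        ← moments_sub]
      congr 1
      funext j
      simp [tau]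
      ring

/-- The formal power series with the real coefficients `v 0, …, v 4` in the variable `y`. -/
def series (y : ℂ⟦X⟧) (v : Fin 5 → Fin 13 → ℝ) : Fin 13 → ℂ⟦X⟧ :=
  fun i => ∑ n, PowerSeries.C ((v n i : ℝ) : ℂ) * y ^ (n : ℕ)

theorem const_mulVec_series (A : Matrix (Fin 13) (Fin 13) ℝ) (y : ℂ⟦X⟧)
    (v : Fin 5 → Fin 13 → ℝ) : const A *ᵥ series y v = series y fun n => A *ᵥ v n := by
  funext i
  simp only [series, Matrix.mulVec, dotProduct, Finset.mul_sum, const, Matrix.map_apply]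
  rw [Finset.sum_comm]
  simp only [Complex.ofReal_sum, Complex.ofReal_mul, map_sum, map_mul, Finset.sum_mul, mul_assoc]

theorem dvd_mulVec_sub {n : Type*} [Fintype n] {N : ℕ} (A : Matrix n n ℂ⟦X⟧) {u v : n → ℂ⟦X⟧}
    {c : ℂ⟦X⟧} (h : ∀ j, X ^ N ∣ u j - c * v j) (i : n) :
    X ^ N ∣ (A *ᵥ u) i - c * (A *ᵥ v) i := by
  simp only [Matrix.mulVec, dotProduct, Finset.mul_sum, ← Finset.sum_sub_distrib]
  refine Finset.dvd_sum fun j _ => ?_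
  rw [mul_left_comm c, ← mul_sub]
  exact (h j).mul_left _

/-- An eigenmode gives an expansion that one time step multiplies by `exp (-Δt ev)`, up to
`O(Δt ^ 5)`. -/
theorem IsMode.timeStep {P : Params} (hlam : P.lam ≠ 0) (hc0 : P.c0 ^ 2 = 4/5 * P.lam ^ 2)
    (hxi : P.xi = 0) {sig : Fin 13 → ℝ} (hsig0 : ∀ i : Fin 4, sig (i.castLE (by norm_num)) = 0)
    (hsig : ∀ i : Fin 13, 4 ≤ (i : ℕ) → rates P i ≠ 0 ∧ sig i = sigma (rates P i))
    {kx ky : ℝ} {e : Fin 4 → ℝ} {h : Fin 4 → Fin 13 → ℝ}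
    (hmode : IsMode sig (equil P.alpha2 P.beta2 P.alpha3 P.beta3) kx ky e h) {y : ℂ⟦X⟧}
    (hy : y = PowerSeries.C (Complex.I * (P.lam : ℂ)) * X) :
    ∃ φ : Fin 13 → ℂ⟦X⟧,
      (∀ i, PowerSeries.constantCoeff (φ i) = ((P.lam ^ momentDegree i * h 0 i : ℝ) : ℂ)) ∧
      ∀ i, X ^ 5 ∣ (D2Q13.timeStep P (kx, ky) *ᵥ φ) i
        - expTrunc (-(y * (PowerSeries.C ((e 0 : ℝ) : ℂ) + PowerSeries.C ((e 1 : ℝ) : ℂ) * y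
            + PowerSeries.C ((e 2 : ℝ) : ℂ) * y ^ 2 + PowerSeries.C ((e 3 : ℝ) : ℂ) * y ^ 3)))
          * φ i := by
  set H : Fin 5 → Fin 13 → ℝ := Fin.snoc h (sig * theta kx ky e h 3) with hH
  set Θ : Fin 5 → Fin 13 → ℝ := Fin.cons 0 (theta kx ky e h) with hΘ
  have hcons (n : Fin 5) (i : Fin 4) : Θ n (i.castLE (by norm_num)) = 0 := by
    refine Fin.cases ?_ (fun n => ?_) n
    · simp [hΘ]
    · rw [hΘ, Fin.cons_succ]; exact hmode.conserved n i
  have hHcast (n : Fin 4) : H n.castSucc = h n := by rw [hH, Fin.snoc_castSucc]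
  have hHeq (n : Fin 5) : H n = equil P.alpha2 P.beta2 P.alpha3 P.beta3 (H n) + sig * Θ n := by
    rcases Fin.eq_castSucc_or_eq_last n with ⟨n, rfl⟩ | rfl
    · rw [hHcast]
      refine Fin.cases ?_ (fun n => ?_) n
      · rw [Fin.castSucc_zero, hΘ, Fin.cons_zero, mul_zero, add_zero]
        exact hmode.zero
      · rw [← Fin.succ_castSucc, hΘ, Fin.cons_succ]
        exact hmode.succ n
    · have h1 : H (Fin.last 4) = sig * Θ (Fin.last 4) := by
        rw [hH, Fin.snoc_last]; rfl
      have h2 (i : Fin 4) : H (Fin.last 4) (i.castLE (by norm_num)) = 0 := by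
        rw [h1, Pi.mul_apply, hsig0, zero_mul]
      have h3 : equil P.alpha2 P.beta2 P.alpha3 P.beta3 (H (Fin.last 4)) = 0 := by
        have := equil_add (al2 := P.alpha2) (be2 := P.beta2) (al3 := P.alpha3) (be3 := P.beta3)
          (h := 0) 1 h2
        simp only [Pi.zero_apply, zero_add, one_mul] at this
        rw [this]
        funext i
        fin_cases i <;> simp [equil]
      rw [h3, zero_add, h1]
  choose g hg using fun n => exists_moments_eq (H n)
  have hτ (n : Fin 5) : moments (tau kx ky e g n) = Θ n :=
    moments_tau kx ky e (fun n => by rw [hg, hHcast]) n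
  -- `gp` and `gm` are the populations before and after collision.
  set gp : Fin 5 → Fin 13 → ℝ := fun n => g n + (1/2 : ℝ) • tau kx ky e g n with hgp
  set gm : Fin 5 → Fin 13 → ℝ := fun n => g n - (1/2 : ℝ) • tau kx ky e g n with hgm
  have hMp (n : Fin 5) : momentMatrix P.lam *ᵥ gp n
      = fun i => P.lam ^ momentDegree i * (H n i + 1/2 * Θ n i) := by
    funext i
    rw [momentMatrix_mulVec, hgp, moments_add, moments_smul, hg, hτ]
    rfl
  have hMm (n : Fin 5) : momentMatrix P.lam *ᵥ gm n
      = fun i => P.lam ^ momentDegree i * (H n i - 1/2 * Θ n i) := by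
    funext i
    rw [momentMatrix_mulVec, hgm, moments_sub, moments_smul, hg, hτ]
    rfl
  have hcoll (n : Fin 5) : collision P *ᵥ (momentMatrix P.lam *ᵥ gp n)
      = momentMatrix P.lam *ᵥ gm n := by
    rw [hMp, hMm, collision_mulVec_mean hc0 hxi hsig (hHeq n) (hcons n)]
  refine ⟨const (momentMatrix P.lam) *ᵥ series y gp, fun i => ?_, ?_⟩
  · rw [const_mulVec_series, series, map_sum, Fin.sum_univ_succ, Finset.sum_eq_zero]
    · rw [hMp]
      have h1 : H 0 = h 0 := hHcast 0
      simp [h1, hΘ]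
    · intro n _
      simp [hy]
  · have h1 : D2Q13.timeStep P (kx, ky) *ᵥ (const (momentMatrix P.lam) *ᵥ series y gp)
        = const (momentMatrix P.lam) *ᵥ (Matrix.diagonal (fun j => PowerSeries.rescale
          (Complex.I * ((kx * (vel P.lam j).1 + ky * (vel P.lam j).2 : ℝ) : ℂ))
          (PowerSeries.exp ℂ)) *ᵥ series y gm) := by
      have h2 : const (collision P) *ᵥ (const (momentMatrix P.lam) *ᵥ series y gp)
          = const (momentMatrix P.lam) *ᵥ series y gm := by
        simp only [const_mulVec_series, hcoll]
      rw [D2Q13.timeStep, ← Matrix.mulVec_mulVec, h2, ← Matrix.mulVec_mulVec,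
        Matrix.mulVec_mulVec (series y gm), ← const_mul, Matrix.nonsing_inv_mul _
        ((Matrix.isUnit_iff_isUnit_det _).1 (isUnit_momentMatrix hlam)), const_one,
        Matrix.one_mulVec, ← Matrix.mulVec_mulVec]
    intro i
    rw [h1]
    refine dvd_mulVec_sub _ (fun j => ?_) i
    rw [Matrix.mulVec_diagonal]
    have hu : IsUnit (PowerSeries.C (Complex.I * (P.lam : ℂ))) :=
      (IsUnit.mk0 _ (mul_ne_zero Complex.I_ne_zero (by exact_mod_cast hlam))).map _
    -- `y = iλΔt` is a unit times `Δt`, so divisibility can be tested in either variable.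
    have hXy (f : ℂ⟦X⟧) : X ^ 5 ∣ f ↔ y ^ 5 ∣ f := by
      rw [hy, mul_pow, (hu.pow 5).mul_left_dvd]
    have hD : y ^ 5 ∣ PowerSeries.rescale
        (Complex.I * ((kx * (vel P.lam j).1 + ky * (vel P.lam j).2 : ℝ) : ℂ)) (PowerSeries.exp ℂ)
        - expTrunc (y * PowerSeries.C ((wave kx ky j : ℝ) : ℂ)) := by
      rw [← hXy]
      convert rescale_exp_sub_expTrunc _ using 3
      rw [hy, mul_right_comm, ← map_mul]
      congr 2
      simp only [vel, wave]
      push_cast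
      ring
    rw [hXy]
    have h2 := transport_expansion (PowerSeries.C ((wave kx ky j : ℝ) : ℂ)) hD
      (e1 := PowerSeries.C ((e 0 : ℝ) : ℂ)) (e2 := PowerSeries.C ((e 1 : ℝ) : ℂ))
      (e3 := PowerSeries.C ((e 2 : ℝ) : ℂ)) (e4 := PowerSeries.C ((e 3 : ℝ) : ℂ))
      (g0 := PowerSeries.C ((g 0 j : ℝ) : ℂ)) (g1 := PowerSeries.C ((g 1 j : ℝ) : ℂ))
      (g2 := PowerSeries.C ((g 2 j : ℝ) : ℂ)) (g3 := PowerSeries.C ((g 3 j : ℝ) : ℂ))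
      (g4 := PowerSeries.C ((g 4 j : ℝ) : ℂ)) rfl rfl
    have hsum (f : Fin 5 → Fin 13 → ℝ) : series y f j = PowerSeries.C ((f 0 j : ℝ) : ℂ)
        + PowerSeries.C ((f 1 j : ℝ) : ℂ) * y + PowerSeries.C ((f 2 j : ℝ) : ℂ) * y ^ 2
        + PowerSeries.C ((f 3 j : ℝ) : ℂ) * y ^ 3 + PowerSeries.C ((f 4 j : ℝ) : ℂ) * y ^ 4 := by
      simp [series, Fin.sum_univ_succ]
      ring
    convert h2 using 3
    · rw [hsum]
      simp [hgm, tau, PowerSeries.smul_eq_C_mul]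
      ring
    · rw [hsum]
      simp [hgp, tau, PowerSeries.smul_eq_C_mul]
      ring

end populations

/-! ### Assembly of the four modes -/

section isotropy

/-- The powers of `i` in `y` turn `|k|²` and `|k|` into the symbols of `Δ` and `√Δ`, with real
constants. The factor `e0` in the third constant makes it change sign with the direction of the
acoustic wave. -/
theorem X_mul_isotropicSeries {lam e0 w : ℝ} (a b d : ℝ) {k : ℝ × ℝ} {y : ℂ⟦X⟧}
    (hy : y = PowerSeries.C (Complex.I * (lam : ℂ)) * X)
    (hw : lam * w = e0 * Real.sqrt (k.1 ^ 2 + k.2 ^ 2)) :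
    X * isotropicSeries k e0 (lam ^ 2 * a) (lam ^ 2 * b * e0) (lam ^ 4 * d)
      = y * (PowerSeries.C ((w : ℝ) : ℂ)
        + PowerSeries.C ((a * (k.1 ^ 2 + k.2 ^ 2) : ℝ) : ℂ) * y
        + PowerSeries.C ((b * w * (k.1 ^ 2 + k.2 ^ 2) : ℝ) : ℂ) * y ^ 2
        + PowerSeries.C ((d * (k.1 ^ 2 + k.2 ^ 2) ^ 2 : ℝ) : ℂ) * y ^ 3) := by
  have hw' : (lam : ℂ) * w = e0 * (Real.sqrt (k.1 ^ 2 + k.2 ^ 2) : ℂ) := by exact_mod_cast hw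
  set κ : ℂ := (Real.sqrt (k.1 ^ 2 + k.2 ^ 2) : ℂ) with hκ
  set K : ℝ := k.1 ^ 2 + k.2 ^ 2 with hK
  have e1 : (e0 : ℂ) * sqrtLap k = w * (Complex.I * lam) := by
    rw [sqrtLap]; linear_combination -Complex.I * hw'
  have e2 : ((lam ^ 2 * a : ℝ) : ℂ) * lap k = ((a * K : ℝ) : ℂ) * (Complex.I * lam) ^ 2 := by
    rw [lap, ← hK, mul_pow, Complex.I_sq]; push_cast; ring
  have e3 : ((lam ^ 2 * b * e0 : ℝ) : ℂ) * (lap k * sqrtLap k)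
      = ((b * w * K : ℝ) : ℂ) * (Complex.I * lam) ^ 3 := by
    rw [lap, sqrtLap, ← hK, mul_pow, Complex.I_pow_three]; push_cast
    linear_combination (lam : ℂ) ^ 2 * b * K * Complex.I * hw'
  have e4 : ((lam ^ 4 * d : ℝ) : ℂ) * lap k ^ 2
      = ((d * K ^ 2 : ℝ) : ℂ) * (Complex.I * lam) ^ 4 := by
    rw [lap, ← hK, mul_pow, Complex.I_pow_four]; push_cast; ring
  rw [isotropicSeries, e1, e2, e3, e4, hy]
  simp only [map_mul, map_pow]
  ring

/-- At `Δt = 0` the conserved moments of the four expansions form a diagonal matrix of powers of `λ`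
times the matrix in `hdet`. Both are invertible, and this suffices over power series. -/
theorem eigenvalues_of_expansions {P : Params} (hlam : P.lam ≠ 0)
    (hr : ∀ i : Fin 13, 4 ≤ (i : ℕ) → rates P i ≠ 0) {k : ℝ × ℝ} {φ : Fin 4 → Fin 13 → ℂ⟦X⟧}
    {v : Fin 4 → Fin 13 → ℝ} {ev : Fin 4 → ℂ⟦X⟧}
    (hφ0 : ∀ j i, PowerSeries.constantCoeff (φ j i) = ((P.lam ^ momentDegree i * v j i : ℝ) : ℂ))
    (hφ : ∀ j i, X ^ 5 ∣ (timeStep P k *ᵥ φ j) i - expTrunc (-(X * ev j)) * φ j i)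
    (hdet : (Matrix.of fun a j : Fin 4 => v j (a.castLE (by norm_num))).det ≠ 0) :
    (∃ L, IsEquivalentOperator P k L) ∧
      ∀ L, IsEquivalentOperator P k L → HasEigenvaluesUpTo4 L ev := by
  set Φ : Matrix (Fin 13) (Fin 4) ℂ⟦X⟧ := Matrix.of fun i j => φ j i with hΦ
  have hR : IsUnit (const conserved * Φ).det := by
    rw [PowerSeries.isUnit_iff_constantCoeff, RingHom.map_det]
    have h1 : (PowerSeries.constantCoeff (R := ℂ)).mapMatrix (const conserved * Φ)
        = Complex.ofRealHom.mapMatrix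
          (Matrix.diagonal (fun a : Fin 4 => P.lam ^ momentDegree (a.castLE (by norm_num)))
          * Matrix.of fun a j : Fin 4 => v j (a.castLE (by norm_num))) := by
      ext a j
      have h2 : (const conserved * Φ) a j = φ j (a.castLE (by norm_num)) := by
        rw [Matrix.mul_apply, Finset.sum_eq_single (a.castLE (by norm_num))]
        · simp [const, conserved, hΦ]
        · intro b _ hb
          have : ¬ (b : ℕ) = (a : ℕ) := fun h => hb (Fin.ext h)
          simp [const, conserved, this]
        · simp
      rw [RingHom.mapMatrix_apply, Matrix.map_apply, h2, hφ0]
      simp [Matrix.diagonal_mul]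
    rw [h1, ← RingHom.map_det, Matrix.det_mul, Matrix.det_diagonal]
    refine (IsUnit.mk0 _ (mul_ne_zero (Finset.prod_ne_zero_iff.2 fun a _ => ?_) hdet)).map _
    exact pow_ne_zero _ hlam
  have h : EqUpTo 5 (timeStep P k * Φ)
      (Φ * Matrix.diagonal fun j => expTrunc (-(X * ev j))) := by
    intro i j
    rw [Matrix.mul_diagonal, mul_comm (Φ i j)]
    exact hφ j i
  exact ⟨⟨_, isEquivalentOperator_of_modes hR h⟩,
    fun L hL => hasEigenvaluesUpTo4_of_modes hlam hr hR h hL⟩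

/-- For `k = 0` the shear and acoustic columns degenerate. There the equilibria themselves serve as
modes, since the collision fixes them. -/
theorem eigenvalues_zero_wave {P : Params} (hlam : P.lam ≠ 0)
    (hr : ∀ i : Fin 13, 4 ≤ (i : ℕ) → rates P i ≠ 0) {ev : Fin 4 → ℂ⟦X⟧} (hev : ev = 0) :
    (∃ L, IsEquivalentOperator P (0, 0) L) ∧
      ∀ L, IsEquivalentOperator P (0, 0) L → HasEigenvaluesUpTo4 L ev := by
  have hR : IsUnit (const conserved * const (equilibrium P)).det := by
    rw [← const_mul, conserved_mul_equilibrium, const_one, Matrix.det_one]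
    exact isUnit_one
  have h : EqUpTo 5 (timeStep P (0, 0) * const (equilibrium P))
      (const (equilibrium P) * Matrix.diagonal fun j => expTrunc (-(X * ev j))) := by
    have h1 : (fun j => expTrunc (-(X * ev j))) = fun _ => 1 := by
      funext j
      simp [hev, expTrunc_eq]
    rw [timeStep_zero hlam, ← const_mul, collision_mul_equilibrium, h1, Matrix.diagonal_one,
      Matrix.mul_one]
    exact EqUpTo.refl _
  exact ⟨⟨_, isEquivalentOperator_of_modes hR h⟩,
    fun L hL => hasEigenvaluesUpTo4_of_modes hlam hr hR h hL⟩

theorem det_modes_ne_zero {kx ky w : ℝ} (hK : kx ^ 2 + ky ^ 2 ≠ 0) (hw : w ≠ 0) :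
    (!![0, 1, w, -w;
        -ky, 0, -4/5 * kx, -4/5 * kx;
        kx, 0, -4/5 * ky, -4/5 * ky;
        0, -28, -36/5 * w, -36/5 * -w] : Matrix (Fin 4) (Fin 4) ℝ).det ≠ 0 := by
  have : (!![0, 1, w, -w;
        -ky, 0, -4/5 * kx, -4/5 * kx;
        kx, 0, -4/5 * ky, -4/5 * ky;
        0, -28, -36/5 * w, -36/5 * -w] : Matrix (Fin 4) (Fin 4) ℝ).det
      = 832/25 * w * (kx ^ 2 + ky ^ 2) := by
    simp [Matrix.det_succ_row_zero, Fin.sum_univ_succ, Fin.succAbove]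
    ring
  rw [this]
  exact mul_ne_zero (mul_ne_zero (by norm_num) hw) hK

theorem fourthOrderIsotropic {P : Params} (hlam : 0 < P.lam)
    (hr : ∀ i : Fin 13, 4 ≤ (i : ℕ) → rates P i ≠ 0) (hc : P.c0 ≠ 0)
    (hc0 : P.c0 ^ 2 = 4/5 * P.lam ^ 2) (hxi : P.xi = 0)
    (hst : 12 * sigma P.s5 * sigma P.s7 = 1) (hs9 : sigma P.s9 = sigma P.s7)
    (hs13 : sigma P.s13 = sigma P.s5)
    (hA : 1313/9042 * P.alpha2 - 18382/4521 * P.beta2 + 234/685 * P.alpha3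
      - 6552/685 * P.beta3 - 2678/165 = 0)
    (hB : (108/10549 * P.alpha2 - 3888/52745 * P.beta2 + 32/685 * P.alpha3
        - 1152/3425 * P.beta3 + 992/5775) * sigma P.s5
      + (-59/126588 * P.alpha2 + 177/52745 * P.beta2 + 7/685 * P.alpha3
        - 252/3425 * P.beta3 - 568/5775) * sigma P.s7 = 0) :
    FourthOrderIsotropic P := by
  have hsig0 (i : Fin 4) : dissipation (sigma P.s5) (sigma P.s7) (sigma P.s11) (sigma P.s12)
      (i.castLE (by norm_num)) = 0 := by
    fin_cases i <;> rfl
  have hsig (i : Fin 13) (hi : 4 ≤ (i : ℕ)) : rates P i ≠ 0 ∧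
      dissipation (sigma P.s5) (sigma P.s7) (sigma P.s11) (sigma P.s12) i = sigma (rates P i) := by
    refine ⟨hr i hi, ?_⟩
    fin_cases i <;> simp [dissipation, rates, hs9, hs13] at hi ⊢
  obtain ⟨aa, ba, da, hacoustic⟩ := exists_acoustic (sigma P.s11) (sigma P.s12) hst hB
  obtain ⟨at', dt, hthermal⟩ := exists_thermal (sigma P.s11) (sigma P.s12) hst hA
  set s := sigma P.s5
  -- The entries `P.lam ^ 2 * 0 * 0` are zero, written in the form that `X_mul_isotropicSeries`
  -- produces.
  refine ⟨![P.lam ^ 2 * (-2/5 * s), P.lam ^ 2 * at', P.lam ^ 2 * aa],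
    ![P.lam ^ 2 * 0 * 0, P.lam ^ 2 * 0 * 0, P.lam ^ 2 * ba * P.c0],
    ![P.lam ^ 4 * (4/25 * s ^ 3 + 1/150 * s), P.lam ^ 4 * dt, P.lam ^ 4 * da], ?_⟩
  rintro ⟨kx, ky⟩
  by_cases hK : kx ^ 2 + ky ^ 2 = 0
  · obtain ⟨rfl, rfl⟩ : kx = 0 ∧ ky = 0 := by
      constructor <;> nlinarith [sq_nonneg kx, sq_nonneg ky]
    refine eigenvalues_zero_wave hlam.ne' hr ?_
    funext j
    fin_cases j <;> simp [isotropicSeries, lap, sqrtLap]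
  · set κ := Real.sqrt (kx ^ 2 + ky ^ 2) with hκ
    have hκ2 : κ ^ 2 = kx ^ 2 + ky ^ 2 := Real.sq_sqrt (by positivity)
    have hκ0 : κ ≠ 0 := fun h => hK (by rw [← hκ2, h]; ring)
    -- The dimensionless acoustic frequency; `w` and `-w` share the constants `aa, ba, da`.
    set w := P.c0 * κ / P.lam with hw
    have hw0 : w ≠ 0 := div_ne_zero (mul_ne_zero hc hκ0) hlam.ne'
    have hlw : P.lam * w = P.c0 * κ := mul_div_cancel₀ _ hlam.ne'
    have hww : w * w = 4/5 * (kx ^ 2 + ky ^ 2) := by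
      rw [hw, ← hκ2]
      field_simp
      rw [hc0]
      ring
    obtain ⟨h1, r1, x1, y1, E1, hm1⟩ := hacoustic kx ky w hww
    obtain ⟨h2, r2, x2, y2, E2, hm2⟩ := hacoustic kx ky (-w) (by rw [neg_mul_neg, hww])
    obtain ⟨h3, r3, x3, y3, E3, hm3⟩ := hthermal kx ky
    have hm4 := isMode_shear (s11 := sigma P.s11) (s12 := sigma P.s12) (al2 := P.alpha2)
      (be2 := P.beta2) (al3 := P.alpha3) (be3 := P.beta3) (kx := kx) (ky := ky) hst
    obtain ⟨φ1, hz1, ht1⟩ := hm1.timeStep hlam.ne' hc0 hxi hsig0 hsig rfl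
    obtain ⟨φ2, hz2, ht2⟩ := hm2.timeStep hlam.ne' hc0 hxi hsig0 hsig rfl
    obtain ⟨φ3, hz3, ht3⟩ := hm3.timeStep hlam.ne' hc0 hxi hsig0 hsig rfl
    obtain ⟨φ4, hz4, ht4⟩ := hm4.timeStep hlam.ne' hc0 hxi hsig0 hsig rfl
    refine eigenvalues_of_expansions hlam.ne' hr (φ := ![φ4, φ3, φ1, φ2])
      (v := ![shearExpansion s kx ky 0, h3 0, h1 0, h2 0]) ?_ ?_ ?_
    · intro j
      fin_cases j
      · exact hz4
      · exact hz3
      · exact hz1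
      · exact hz2
    · intro j i
      have key (e0 w a b d : ℝ) (hw : P.lam * w = e0 * κ) :=
        X_mul_isotropicSeries (k := (kx, ky)) a b d rfl hw
      fin_cases j
      · have h := key 0 0 (-2/5 * s) 0 (4/25 * s ^ 3 + 1/150 * s) (by ring)
        have ht := ht4 i
        simp only [shearEigen] at ht
        simp only [Fin.zero_eta, Matrix.cons_val_zero]
        rw [h]
        convert ht using 6; simp
      · have h := key 0 0 at' 0 dt (by ring)
        have ht := ht3 i
        change _ ∣ (timeStep P (kx, ky) *ᵥ φ3) i - expTrunc (-(X * isotropicSeries (kx, ky) 0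
          (P.lam ^ 2 * at') (P.lam ^ 2 * 0 * 0) (P.lam ^ 4 * dt))) * φ3 i
        rw [h]
        convert ht using 6; simp
      · change _ ∣ (timeStep P (kx, ky) *ᵥ φ1) i - expTrunc (-(X * isotropicSeries (kx, ky) P.c0
          (P.lam ^ 2 * aa) (P.lam ^ 2 * ba * P.c0) (P.lam ^ 4 * da))) * φ1 i
        rw [key P.c0 w aa ba da hlw]
        exact ht1 i
      · change _ ∣ (timeStep P (kx, ky) *ᵥ φ2) i - expTrunc (-(X * isotropicSeries (kx, ky) (-P.c0)
          (P.lam ^ 2 * aa) (-(P.lam ^ 2 * ba * P.c0)) (P.lam ^ 4 * da))) * φ2 i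
        rw [← mul_neg (P.lam ^ 2 * ba), key (-P.c0) (-w) aa ba da (by rw [mul_neg, hlw, neg_mul])]
        exact ht2 i
    · convert det_modes_ne_zero hK hw0 using 2
      ext a j
      fin_cases a <;> fin_cases j <;> first | rfl | assumption

end isotropy

end D2Q13

end

theorem mainTheorem5 (P : D2Q13.Params) (hlam : 0 < P.lam)
    (hs5 : P.s5 ≠ 0) (hs7 : P.s7 ≠ 0) (hs9 : P.s9 ≠ 0)
    (hs11 : P.s11 ≠ 0) (hs12 : P.s12 ≠ 0) (hs13 : P.s13 ≠ 0)
    (hsigma5 : D2Q13.sigma P.s5 ≠ 0)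
    (hsigma7 : D2Q13.sigma P.s7 = 1 / (12 * D2Q13.sigma P.s5))
    (hc0 : P.c0 = 2 / Real.sqrt 5 * P.lam)
    (halpha3 : P.alpha3 = -(1 / 1716 *
      (D2Q13.numAlpha P.alpha2 P.beta2 (D2Q13.sigma P.s5)
        / (384 * D2Q13.sigma P.s5 ^ 2 + 7))))
    (hbeta3 : P.beta3 = 1 / 216216 *
      (D2Q13.numBeta P.alpha2 P.beta2 (D2Q13.sigma P.s5)
        / (384 * D2Q13.sigma P.s5 ^ 2 + 7)))
    (hxi : P.xi = 0)
    (hsigma9 : D2Q13.sigma P.s9 = D2Q13.sigma P.s7)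
    (hsigma13 : D2Q13.sigma P.s13 = D2Q13.sigma P.s5) :
    D2Q13.FourthOrderIsotropic P := by
  have hden : 384 * D2Q13.sigma P.s5 ^ 2 + 7 ≠ 0 := by positivity
  have h5 : Real.sqrt 5 ≠ 0 := by positivity
  refine D2Q13.fourthOrderIsotropic hlam ?_ ?_ ?_ hxi ?_ hsigma9 hsigma13 ?_ ?_
  · intro i hi
    fin_cases i <;> simp [D2Q13.rates] at hi ⊢ <;> assumption
  · rw [hc0]
    positivity
  · rw [hc0, mul_pow, div_pow, Real.sq_sqrt (by norm_num)]
    ring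
  · rw [hsigma7]
    field_simp
  -- The two remaining conditions are linear in `α₃ - 28 β₃` and `α₃ - 36/5 β₃`. The coefficient of
  -- the latter is proportional to `32 σ₅ + 7 σ₇ = (384 σ₅² + 7) / (12 σ₅)`, whence the denominator
  -- of `α₃` and `β₃`.
  · rw [halpha3, hbeta3, D2Q13.numAlpha, D2Q13.numBeta]
    field_simp
    ring
  · rw [halpha3, hbeta3, hsigma7, D2Q13.numAlpha, D2Q13.numBeta]
    field_simp
    ring
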